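/- Let $\mathcal M$ be a finite-dimensional $C^\infty$ manifold (Hausdorff, second countable, without boundary, of pure dimension) and let $2\le k\le\infty$. A \emph{$C^k$ discretization of $T\mathcal M$} is a tuple $(\psi,\alpha^+,\alpha^-)$ with $\psi:U\subseteq\mathbb R^2\times T\mathcal M\to\mathcal M$, $\alpha^+:[0,a_0)\to\mathbb R_{\ge0}$ and $\alpha^-:[0,a_0)\to\mathbb R_{\le0}$ for some $a_0>0$, such that: (a) $U$ is open, $\{0\}\times\{0\}\times T\mathcal M\subseteq U$, and $\psi$ is continuous; (b) $\alpha^+,\alpha^-$ are $C^1$ and $\alpha^+(h)-\alpha^-(h)=h$; (c) $\psi(h,0,v_m)=m$ and $\frac{\partial\psi}{\partial t}(h,0,v_m)=v_m$ whenever $v_m\in T_m\mathcal M$ and $(h,0,v_m)\in U$; (d) the boundary maps $\partial_h^{+}(v_m)=\psi(h,\alpha^{+}(h),v_m)$ and $\partial_h^{-}(v_m)=\psi(h,\alpha^{-}(h),v_m)$ are $C^k$ in $(h,v_m)$ on their natural domains (the sets of $(h,v_m)$ with $h\in[0,a_0)$ at which the right-hand side is defined), and $\frac{d}{dh}\big|_{h=0}\partial_h^{+}(v_m)=\dot\alpha^{+}v_m$,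 $\frac{d}{dh}\big|_{h=0}\partial_h^{-}(v_m)=\dot\alpha^{-}v_m$, where $\dot\alpha^{\pm}=\frac{d\alpha^{\pm}}{dh}(0)$ (derivatives at $h=0$ are one-sided). A \emph{discrete tangent bundle} of a manifold $\mathcal N$ is a tuple $(\mathcal V,\partial^+,\partial^-)$ where $\mathcal V$ is a manifold with $\dim\mathcal V=2\dim\mathcal N$ and $\partial^+,\partial^-:\mathcal V\to\mathcal N$ are ($C^k$) submersions with $\ker T\partial^+\cap\ker T\partial^-=0$ such that for every $n\in\mathcal N$ the fibres $(\partial^+)^{-1}(n)$ and $(\partial^-)^{-1}(n)$ meet in exactly one point. \textbf{Proposition.} Let $(\psi,\alpha^+,\alpha^-)$ be a $C^k$ discretization of $T\mathcal M$ and let $\mathcal M_0\subseteq\mathcal M$ be a relatively compact open set. Then there are $a>0$ and a family of open sets $\mathcal V_h\subseteq T\mathcal M$ such that for all $h\in(0,a)$ the maps $\partial_h^+$ and $\partial_h^-$ are defined on $\mathcal V_h$ with values in $\mathcal M_0$, and 1. $(\mathcal V_h,\partial_h^+,\partial_h^-)$ is a discrete tangent bundle of $\mathcal M_0$; 2. $\partial_h^\pm=(\partial_h^+,\partial_h^-)$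 is a $C^k$ diffeomorphism from $\mathcal V_h$ onto an open subset of $\mathcal M_0\times\mathcal M_0$ containing the diagonal $\Delta(\mathcal M_0\times\mathcal M_0)$. Moreover, for every $v_m\in T_m\mathcal M$ with $m\in\mathcal M_0$ one has $v_m\in\mathcal V_h$ for all sufficiently small $h>0$. -/

import Mathlib

open Set Filter Topology TopologicalSpace
open scoped Manifold ContDiff

section DiscreteTangentBundles

/-- The curve `c`, defined on `s ⊆ ℝ`, is differentiable at the time `t` (one-sidedly if `t` is an
end point of `s`), and its velocity there is the tangent vector `v`. In particular `c t` is the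
base point of `v`. Only used where `s` is a neighbourhood or a one-sided neighbourhood of `t`. -/
def HasVelocityWithinAt {E : Type*} [NormedAddCommGroup E] [NormedSpace ℝ E]
    {M : Type*} [TopologicalSpace M] [ChartedSpace E M]
    (c : ℝ → M) (s : Set ℝ) (t : ℝ) (v : TangentBundle 𝓘(ℝ, E) M) : Prop :=
  MDifferentiableWithinAt 𝓘(ℝ, ℝ) 𝓘(ℝ, E) c s t ∧
    (⟨c t, mfderivWithin 𝓘(ℝ, ℝ) 𝓘(ℝ, E) c s t 1⟩ : TangentBundle 𝓘(ℝ, E) M) = v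

/-- A `C^k` discretization `(ψ, α⁺, α⁻)` of the tangent bundle `TM` of a manifold `M` modelled
on `E`. The partial maps `ψ : U ⊆ ℝ × ℝ × TM → M` and `α^± : [0, a) → ℝ` are total functions
here, of which only the values on `U` and on `[0, a)` are ever used. -/
structure TangentBundleDiscretization (E : Type*) [NormedAddCommGroup E] [NormedSpace ℝ E]
    (M : Type*) [TopologicalSpace M] [ChartedSpace E M] [IsManifold 𝓘(ℝ, E) ∞ M] (k : ℕ∞) where
  one_le : 1 ≤ k
  /-- the domain of `ψ` -/
  U : Set (ℝ × ℝ × TangentBundle 𝓘(ℝ, E) M)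
  /-- the curve segments `t ↦ ψ h t v` -/
  ψ : ℝ → ℝ → TangentBundle 𝓘(ℝ, E) M → M
  /-- the length of the interval of definition of `α⁺` and `α⁻` -/
  a : ℝ
  αplus : ℝ → ℝ
  αminus : ℝ → ℝ
  a_pos : 0 < a
  isOpen_U : IsOpen U
  zero_mem_U : ∀ v : TangentBundle 𝓘(ℝ, E) M, (0, 0, v) ∈ U
  continuousOn_ψ :
    ContinuousOn (fun p : ℝ × ℝ × TangentBundle 𝓘(ℝ, E) M => ψ p.1 p.2.1 p.2.2) U
  αplus_nonneg : ∀ h ∈ Ico 0 a, 0 ≤ αplus h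
  αminus_nonpos : ∀ h ∈ Ico 0 a, αminus h ≤ 0
  contDiffOn_αplus : ContDiffOn ℝ 1 αplus (Ico 0 a)
  contDiffOn_αminus : ContDiffOn ℝ 1 αminus (Ico 0 a)
  αplus_sub_αminus : ∀ h ∈ Ico 0 a, αplus h - αminus h = h
  /-- `ψ(h, 0, v) = m` and `∂ψ/∂t (h, 0, v) = v` for `v ∈ T_m M` -/
  velocity_ψ : ∀ (h : ℝ) (v : TangentBundle 𝓘(ℝ, E) M), (h, 0, v) ∈ U →
    HasVelocityWithinAt (fun t => ψ h t v) univ 0 v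
  /-- the boundary map `(h, v) ↦ ψ(h, α⁺(h), v)` is `C^k` on its domain -/
  contMDiffOn_plus :
    ContMDiffOn (𝓘(ℝ, ℝ).prod 𝓘(ℝ, E).tangent) 𝓘(ℝ, E) k
      (fun p : ℝ × TangentBundle 𝓘(ℝ, E) M => ψ p.1 (αplus p.1) p.2)
      {p | p.1 ∈ Ico 0 a ∧ (p.1, αplus p.1, p.2) ∈ U}
  /-- the boundary map `(h, v) ↦ ψ(h, α⁻(h), v)` is `C^k` on its domain -/
  contMDiffOn_minus :
    ContMDiffOn (𝓘(ℝ, ℝ).prod 𝓘(ℝ, E).tangent) 𝓘(ℝ, E) k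
      (fun p : ℝ × TangentBundle 𝓘(ℝ, E) M => ψ p.1 (αminus p.1) p.2)
      {p | p.1 ∈ Ico 0 a ∧ (p.1, αminus p.1, p.2) ∈ U}
  /-- `d/dh ∂⁺_h(v) = (dα⁺/dh)(0) v` at `h = 0` -/
  velocity_plus : ∀ v : TangentBundle 𝓘(ℝ, E) M,
    HasVelocityWithinAt (fun h => ψ h (αplus h) v) (Ico 0 a) 0
      ⟨v.proj, derivWithin αplus (Ico 0 a) 0 • v.snd⟩
  /-- `d/dh ∂⁻_h(v) = (dα⁻/dh)(0) v` at `h = 0` -/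
  velocity_minus : ∀ v : TangentBundle 𝓘(ℝ, E) M,
    HasVelocityWithinAt (fun h => ψ h (αminus h) v) (Ico 0 a) 0
      ⟨v.proj, derivWithin αminus (Ico 0 a) 0 • v.snd⟩

namespace TangentBundleDiscretization

variable {E : Type*} [NormedAddCommGroup E] [NormedSpace ℝ E]
  {M : Type*} [TopologicalSpace M] [ChartedSpace E M] [IsManifold 𝓘(ℝ, E) ∞ M] {k : ℕ∞}

/-- The boundary map `∂⁺_h`. -/
def bdryPlus (D : TangentBundleDiscretization E M k) (h : ℝ)
    (v : TangentBundle 𝓘(ℝ, E) M) : M :=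
  D.ψ h (D.αplus h) v

/-- The boundary map `∂⁻_h`. -/
def bdryMinus (D : TangentBundleDiscretization E M k) (h : ℝ)
    (v : TangentBundle 𝓘(ℝ, E) M) : M :=
  D.ψ h (D.αminus h) v

/-- The set of tangent vectors at which both `∂⁺_h` and `∂⁻_h` are defined. -/
def bdryDomain (D : TangentBundleDiscretization E M k) (h : ℝ) :
    Set (TangentBundle 𝓘(ℝ, E) M) :=
  {v | h ∈ Ico 0 D.a ∧ (h, D.αplus h, v) ∈ D.U ∧ (h, D.αminus h, v) ∈ D.U}

end TangentBundleDiscretization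

/-- `(V, ∂⁺, ∂⁻)` is a (`C^k`) discrete tangent bundle of the manifold `M`: `V` is a manifold
(Hausdorff and second countable, the rest being in the instances) of dimension `2 dim M`, and
`∂⁺, ∂⁻ : V → M` are submersions such that `ker T∂⁺ ∩ ker T∂⁻ = 0` and such that the fibres
of `∂⁺` and `∂⁻` over each `m` meet in exactly one point. -/
structure IsDiscreteTangentBundle
    {F : Type*} [NormedAddCommGroup F] [NormedSpace ℝ F] [FiniteDimensional ℝ F]
    {G : Type*} [TopologicalSpace G] (J : ModelWithCorners ℝ F G) [J.Boundaryless]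
    {E : Type*} [NormedAddCommGroup E] [NormedSpace ℝ E] [FiniteDimensional ℝ E]
    {H : Type*} [TopologicalSpace H] (I : ModelWithCorners ℝ E H) [I.Boundaryless]
    (k : ℕ∞)
    {V : Type*} [TopologicalSpace V] [ChartedSpace G V] [IsManifold J ∞ V]
    {M : Type*} [TopologicalSpace M] [ChartedSpace H M] [IsManifold I ∞ M]
    (dplus dminus : V → M) : Prop where
  t2Space : T2Space V
  secondCountable : SecondCountableTopology V
  finrank_eq : Module.finrank ℝ F = 2 * Module.finrank ℝ E
  isSubmersion_plus : Manifold.IsSubmersion J I k dplus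
  isSubmersion_minus : Manifold.IsSubmersion J I k dminus
  ker_inf_ker : ∀ v : V, ∀ w : TangentSpace J v,
    mfderiv J I dplus v w = 0 → mfderiv J I dminus v w = 0 → w = 0
  existsUnique_zero : ∀ m : M, ∃! v : V, dplus v = m ∧ dminus v = m

end DiscreteTangentBundles

/-!
At `h = 0` both boundary maps are the projection of `TM`, so the pair `(∂⁺_h, ∂⁻_h)` degenerates.
Its second component is therefore replaced, in a chart, by the difference quotient
`(∂⁺_h - ∂⁻_h) / (h (c⁺ - c⁻))`, where `c^±` are the derivatives of `α^±` at `0`. For fixed `h > 0`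
this is a linear change of coordinates, and as `h → 0` the rescaled pair tends to the identity of
`TM`. Since the boundary maps are `C²` in `(h, v)`, it does so with locally small Lipschitz constant
of the difference to the identity, so a uniform version of the inverse function theorem shows that
over every compact set of `TM` and for all small `h > 0` the pair is an injective local
diffeomorphism, and that its image contains any given compact part of the diagonal, which it attains
near the zero section. Exhausting `TM` by compact sets that grow slowly as `h → 0` gives `V_h`.
-/

section Analysis

variable {X Y : Type*} [NormedAddCommGroup X] [NormedSpace ℝ X]
  [NormedAddCommGroup Y] [NormedSpace ℝ Y]

theorem exists_approximatesLinearOn_fderivWithin {f : X → Y} {s : Set X} {x₀ : X}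
    (hf : ContDiffWithinAt ℝ 1 f s x₀) (hs : Convex ℝ s) (hs' : UniqueDiffOn ℝ s) (hx₀ : x₀ ∈ s)
    {ε : NNReal} (hε : 0 < ε) :
    ∃ t ∈ 𝓝[s] x₀, ApproximatesLinearOn f (fderivWithin ℝ f s x₀) t ε := by
  have hcont : ContinuousWithinAt (fderivWithin ℝ f s) s x₀ :=
    (hf.fderivWithin_right (m := 0) hs' le_rfl hx₀).continuousWithinAt
  have hdiff : ∀ᶠ x in 𝓝[s] x₀, ContDiffWithinAt ℝ 1 f s x := by
    simpa only [insert_eq_of_mem hx₀] using hf.eventually (by simp)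
  have hclose : ∀ᶠ x in 𝓝[s] x₀, dist (fderivWithin ℝ f s x) (fderivWithin ℝ f s x₀) < ε :=
    hcont (Metric.ball_mem_nhds _ (NNReal.coe_pos.2 hε))
  obtain ⟨r, hr, hball⟩ := Metric.mem_nhdsWithin_iff.1 (hdiff.and hclose)
  refine ⟨Metric.ball x₀ r ∩ s, inter_mem
      (mem_nhdsWithin_of_mem_nhds (Metric.ball_mem_nhds x₀ hr)) self_mem_nhdsWithin,
    fun x hx y hy => ?_⟩
  refine Convex.norm_image_sub_le_of_norm_hasFDerivWithin_le' (f' := fderivWithin ℝ f s)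
    (fun z hz => ?_) (fun z hz => ?_) ((convex_ball x₀ r).inter hs) hy hx
  · exact ((hball hz).1.differentiableWithinAt one_ne_zero).hasFDerivWithinAt.mono
      inter_subset_right
  · rw [← dist_eq_norm]
    exact (hball hz).2.le

theorem exists_lipschitzOnWith_sub_of_contDiffWithinAt {T : Set X} (hT : Convex ℝ T)
    (hT' : UniqueDiffOn ℝ T) {Z : Type*} [NormedAddCommGroup Z] [NormedSpace ℝ Z]
    {F : X × Z → Y} {t₀ : X} (ht₀ : t₀ ∈ T) {z₀ : Z}
    (hF : ContDiffWithinAt ℝ 1 F (T ×ˢ univ) (t₀, z₀)) {ε : NNReal} (hε : 0 < ε) :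
    ∃ u ∈ 𝓝 z₀, ∀ᶠ t in 𝓝[T] t₀, LipschitzOnWith ε (fun z => F (t, z) - F (t₀, z)) u := by
  obtain ⟨s, hs, happrox⟩ := exists_approximatesLinearOn_fderivWithin hF
    (hT.prod convex_univ) (hT'.prod uniqueDiffOn_univ) ⟨ht₀, mem_univ _⟩ (half_pos hε)
  rw [nhdsWithin_prod_eq, nhdsWithin_univ] at hs
  obtain ⟨A, hA, u, hu, hAu⟩ := mem_prod_iff.1 hs
  refine ⟨u, hu, mem_of_superset hA fun t ht => LipschitzOnWith.of_dist_le_mul fun z hz w hw => ?_⟩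
  set L := fderivWithin ℝ F (T ×ˢ univ) (t₀, z₀)
  have hslice : ∀ t ∈ A, ‖F (t, z) - F (t, w) - L (0, z - w)‖ ≤ ε / 2 * ‖z - w‖ := fun t ht => by
    simpa [Prod.norm_mk] using happrox (t, z) (hAu ⟨ht, hz⟩) (t, w) (hAu ⟨ht, hw⟩)
  rw [dist_eq_norm, dist_eq_norm]
  calc ‖F (t, z) - F (t₀, z) - (F (t, w) - F (t₀, w))‖
      = ‖(F (t, z) - F (t, w) - L (0, z - w)) - (F (t₀, z) - F (t₀, w) - L (0, z - w))‖ := by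
        congr 1; abel
    _ ≤ ε / 2 * ‖z - w‖ + ε / 2 * ‖z - w‖ :=
        norm_sub_le_of_le (hslice t ht) (hslice t₀ (mem_of_mem_nhdsWithin ht₀ hA))
    _ = ε * ‖z - w‖ := by ring

theorem eventually_hasDerivWithinAt_fst {F : ℝ × X → Y} {T : Set ℝ} {t₀ : ℝ} (ht₀ : t₀ ∈ T)
    {z₀ : X} (hF : ContDiffWithinAt ℝ 1 F (T ×ˢ univ) (t₀, z₀)) :
    ∀ᶠ p : ℝ × X in 𝓝[T] t₀ ×ˢ 𝓝 z₀, HasDerivWithinAt (fun t => F (t, p.2))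
      (fderivWithin ℝ F (T ×ˢ univ) p (1, 0)) T p.1 := by
  have hdiff : ∀ᶠ p in 𝓝[T] t₀ ×ˢ 𝓝 z₀, ContDiffWithinAt ℝ 1 F (T ×ˢ univ) p := by
    have hmem : (t₀, z₀) ∈ T ×ˢ (univ : Set X) := ⟨ht₀, mem_univ _⟩
    simpa only [insert_eq_of_mem hmem, nhdsWithin_prod_eq, nhdsWithin_univ]
      using hF.eventually (by simp)
  filter_upwards [hdiff] with p hp
  have hslice : HasDerivWithinAt (fun t : ℝ => (t, p.2)) ((1 : ℝ), (0 : X)) T p.1 :=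
    (hasDerivWithinAt_id _ _).prodMk (hasDerivWithinAt_const _ _ _)
  have hmaps : MapsTo (fun t : ℝ => (t, p.2)) T (T ×ˢ univ) := fun t ht => ⟨ht, mem_univ _⟩
  exact (hp.differentiableWithinAt one_ne_zero).hasFDerivWithinAt.comp_hasDerivWithinAt p.1
    hslice hmaps

theorem norm_smul_sub_sub_le_of_hasDerivWithinAt {g g' : ℝ → Y} {b : Y} {C h : ℝ} (hh : 0 < h)
    (hg : ∀ s ∈ Icc 0 h, HasDerivWithinAt g (g' s) (Icc 0 h) s)
    (hbound : ∀ s ∈ Ico 0 h, ‖g' s - b‖ ≤ C) : ‖h⁻¹ • (g h - g 0) - b‖ ≤ C := by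
  have hsub : ∀ s ∈ Icc 0 h,
      HasDerivWithinAt (fun s => g s - s • b) (g' s - b) (Icc 0 h) s := fun s hs =>
    ((hg s hs).sub ((hasDerivWithinAt_id s _).smul_const b)).congr_deriv (by rw [one_smul])
  have hmean := norm_image_sub_le_of_norm_deriv_le_segment' hsub hbound h ⟨hh.le, le_rfl⟩
  calc ‖h⁻¹ • (g h - g 0) - b‖
      = ‖h⁻¹ • (g h - h • b - (g 0 - (0 : ℝ) • b))‖ := by
        rw [zero_smul, sub_zero, sub_right_comm, smul_sub _ _ (h • b), inv_smul_smul₀ hh.ne']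
    _ = h⁻¹ * ‖g h - h • b - (g 0 - (0 : ℝ) • b)‖ := by
        rw [norm_smul, Real.norm_of_nonneg (inv_nonneg.2 hh.le)]
    _ ≤ C := by
        rw [sub_zero] at hmean
        rwa [inv_mul_le_iff₀ hh, mul_comm h]

theorem exists_lipschitzOnWith_inv_smul_sub {F : ℝ × X → Y} {z₀ : X} {B : X → Y}
    (hF : ContDiffWithinAt ℝ 2 F (Ici 0 ×ˢ univ) (0, z₀))
    (hB : ∀ᶠ z in 𝓝 z₀, HasDerivWithinAt (fun h => F (h, z)) (B z) (Ici 0) 0)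
    {ε : NNReal} (hε : 0 < ε) :
    ∃ u ∈ 𝓝 z₀, ∀ᶠ h in 𝓝[>] (0 : ℝ),
      LipschitzOnWith ε (fun z => h⁻¹ • (F (h, z) - F (0, z)) - B z) u := by
  -- `C²` enters here: `P = ∂F/∂h` is `C¹`, so `P (s, ·) - P (0, ·)` has a small Lipschitz constant,
  -- which the mean value inequality in `h` transfers to the difference quotient.
  set P : ℝ × X → Y := fun p => fderivWithin ℝ F (Ici 0 ×ˢ univ) p (1, 0)
  have hP : ContDiffWithinAt ℝ 1 P (Ici 0 ×ˢ univ) (0, z₀) :=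
    hF.fderivWithin_right_apply contDiffWithinAt_const
      ((uniqueDiffOn_Ici 0).prod uniqueDiffOn_univ) (by norm_num) ⟨self_mem_Ici, mem_univ _⟩
  obtain ⟨u₁, hu₁, hlip⟩ := exists_lipschitzOnWith_sub_of_contDiffWithinAt (convex_Ici 0)
    (uniqueDiffOn_Ici 0) self_mem_Ici hP hε
  obtain ⟨A, hA, u₂, hu₂, hderiv⟩ := eventually_prod_iff.1
    (eventually_hasDerivWithinAt_fst self_mem_Ici (hF.of_le one_le_two))
  obtain ⟨δ, hδ, hIco⟩ := mem_nhdsGE_iff_exists_Ico_subset.1 (hlip.and hA)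
  have hslice : ∀ s ∈ Ico 0 δ, ∀ z, u₂ z →
      HasDerivWithinAt (fun t => F (t, z)) (P (s, z)) (Ici 0) s := fun s hs z hz =>
    hderiv (hIco hs).2 hz
  have hPB : ∀ᶠ z in 𝓝 z₀, u₂ z ∧ P (0, z) = B z := by
    filter_upwards [hu₂, hB] with z hz hBz
    exact ⟨hz, (uniqueDiffOn_Ici 0 0 self_mem_Ici).eq_deriv _ (hslice 0 ⟨le_rfl, hδ⟩ z hz) hBz⟩
  refine ⟨_, inter_mem hu₁ hPB, ?_⟩
  filter_upwards [Ioo_mem_nhdsGT hδ] with h hh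
  refine LipschitzOnWith.of_dist_le_mul fun z ⟨hz, hz₂, hPz⟩ w ⟨hw, hw₂, hPw⟩ => ?_
  have hIcc : ∀ s ∈ Icc 0 h, s ∈ Ico 0 δ := fun s hs => ⟨hs.1, hs.2.trans_lt hh.2⟩
  have hmean := norm_smul_sub_sub_le_of_hasDerivWithinAt (b := B z - B w) (C := ε * ‖z - w‖) hh.1
    (fun s hs => ((hslice s (hIcc s hs) z hz₂).sub (hslice s (hIcc s hs) w hw₂)).mono
      Icc_subset_Ici_self)
    fun s hs => by
      have := (hIco (hIcc s (Ico_subset_Icc_self hs))).1.dist_le_mul z hz w hw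
      rwa [dist_eq_norm, dist_eq_norm, hPz, hPw, sub_sub_sub_comm] at this
  rw [dist_eq_norm, dist_eq_norm, sub_sub_sub_comm, ← smul_sub, sub_sub_sub_comm]
  exact hmean

end Analysis

section InverseFunction

variable {X Y : Type*} [NormedAddCommGroup X] [NormedSpace ℝ X] [CompleteSpace X]
  [NormedAddCommGroup Y] [NormedSpace ℝ Y]

theorem exists_hasFDerivAt_equiv_of_approximatesLinearOn_id {f : X → X} {s : Set X} {c : NNReal}
    (hf : ApproximatesLinearOn f (ContinuousLinearMap.id ℝ X) s c) (hc : c < 1) {x : X}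
    (hs : s ∈ 𝓝 x) (hd : DifferentiableAt ℝ f x) :
    ∃ A : X ≃L[ℝ] X, HasFDerivAt f (A : X →L[ℝ] X) x := by
  have hle : ‖fderiv ℝ f x - ContinuousLinearMap.id ℝ X‖ ≤ c :=
    (hd.hasFDerivAt.sub (ContinuousLinearMap.id ℝ X).hasFDerivAt).le_of_lipschitzOn hs
      hf.lipschitzOnWith
  have hlt : ‖ContinuousLinearMap.id ℝ X - fderiv ℝ f x‖ < 1 := by
    rw [norm_sub_rev]
    exact hle.trans_lt hc
  refine ⟨ContinuousLinearEquiv.unitsEquiv ℝ X (Units.oneSub _ hlt),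
    hd.hasFDerivAt.congr_fderiv ?_⟩
  ext w
  simp

theorem isLocalDiffeomorphAt_of_hasFDerivAt_equiv {f : X → Y} {x : X} {n : WithTop ℕ∞}
    (hn : n ≠ 0) (hf : ∀ᶠ y in 𝓝 x, ContDiffAt ℝ n f y) {f' : X ≃L[ℝ] Y}
    (hf' : HasFDerivAt f (f' : X →L[ℝ] Y) x) :
    IsLocalDiffeomorphAt 𝓘(ℝ, X) 𝓘(ℝ, Y) n f x := by
  have hfx := hf.self_of_nhds
  have hinv : ∀ᶠ y in 𝓝 x, fderiv ℝ f y ∈ range ((↑) : (X ≃L[ℝ] Y) → X →L[ℝ] Y) :=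
    (hfx.continuousAt_fderiv hn).eventually (hf'.fderiv ▸ ContinuousLinearEquiv.nhds f')
  obtain ⟨u, hu, huo, hxu⟩ := eventually_nhds_iff.1 (hf.and hinv)
  let e := (hfx.toOpenPartialHomeomorph f hf' hn).restrOpen u huo
  refine ⟨{ toPartialEquiv := e.toPartialEquiv
            open_source := e.open_source
            open_target := e.open_target
            contMDiffOn_toFun := fun y hy => (hu y hy.2).1.contMDiffAt.contMDiffWithinAt
            contMDiffOn_invFun := fun y hy => ?_ },
    ⟨hfx.mem_toOpenPartialHomeomorph_source hf' hn, hxu⟩, fun _ _ => rfl⟩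
  obtain ⟨hdiff, A, hA⟩ := hu _ (e.map_target hy).2
  have hderiv : HasFDerivAt e (A : X →L[ℝ] Y) (e.symm y) :=
    hA ▸ (hdiff.differentiableAt hn).hasFDerivAt
  exact (e.contDiffAt_symm hy hderiv hdiff).contMDiffAt.contMDiffWithinAt

end InverseFunction

section ApproximatesIdAt

variable {X : Type*} [NormedAddCommGroup X] [NormedSpace ℝ X] {ι : Type*}

/-- The maps `G i` tend to the identity at `z₀` along `l`, in the sense needed for a version of the
inverse function theorem that is uniform in `i`: on one neighbourhood of `z₀` the differences
`G i - id` have, eventually, the Lipschitz constant `1 / 2`, and `G i z₀` tends to `z₀`. -/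
structure ApproximatesIdAt (G : ι → X → X) (l : Filter ι) (z₀ : X) : Prop where
  exists_approximatesLinearOn : ∃ s ∈ 𝓝 z₀, ∀ᶠ i in l,
    ApproximatesLinearOn (G i) (ContinuousLinearMap.id ℝ X) s (1 / 2)
  tendsto : Tendsto (fun i => G i z₀) l (𝓝 z₀)

namespace ApproximatesIdAt

variable {G : ι → X → X} {l : Filter ι} {z₀ : X}

theorem tendsto_uncurry (hG : ApproximatesIdAt G l z₀) :
    Tendsto (fun p : ι × X => G p.1 p.2) (l ×ˢ 𝓝 z₀) (𝓝 z₀) := by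
  obtain ⟨s, hs, happrox⟩ := hG.exists_approximatesLinearOn
  have hsub : Tendsto (fun p : ι × X => p.2 - z₀) (l ×ˢ 𝓝 z₀) (𝓝 0) := by
    simpa using (tendsto_snd (f := l) (g := 𝓝 z₀)).sub_const z₀
  have hrem : Tendsto (fun p : ι × X => G p.1 p.2 - G p.1 z₀ - (p.2 - z₀)) (l ×ˢ 𝓝 z₀) (𝓝 0) := by
    refine squeeze_zero_norm' ?_ (by simpa using hsub.norm.const_mul (1 / 2))
    filter_upwards [happrox.prod_mk hs] with p ⟨hp, hps⟩
    simpa using hp p.2 hps z₀ (mem_of_mem_nhds hs)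
  have hsum := (hrem.add hsub).add (hG.tendsto.comp tendsto_fst)
  simp only [sub_add_cancel, Function.comp_def, zero_add] at hsum
  exact hsum

theorem eventually_eq_of_eq {w₀ : X} (hz : ApproximatesIdAt G l z₀)
    (hw : ApproximatesIdAt G l w₀) :
    ∀ᶠ p : ι × X × X in l ×ˢ (𝓝 z₀ ×ˢ 𝓝 w₀), G p.1 p.2.1 = G p.1 p.2.2 → p.2.1 = p.2.2 := by
  rcases eq_or_ne z₀ w₀ with rfl | hne
  · obtain ⟨s, hs, happrox⟩ := hz.exists_approximatesLinearOn
    filter_upwards [happrox.prod_mk (prod_mem_prod hs hs)] with ⟨i, z, w⟩ ⟨hi, hzs, hws⟩ heq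
    have hle := hi z hzs w hws
    simp only [heq, sub_self, ContinuousLinearMap.id_apply, zero_sub, norm_neg] at hle
    have hzero : ‖z - w‖ ≤ 0 := by push_cast at hle; linarith
    exact sub_eq_zero.1 (norm_le_zero_iff.1 hzero)
  · have hzG : Tendsto (fun p : ι × X × X => G p.1 p.2.1) (l ×ˢ (𝓝 z₀ ×ˢ 𝓝 w₀)) (𝓝 z₀) :=
      hz.tendsto_uncurry.comp (tendsto_fst.prodMk (tendsto_fst.comp tendsto_snd))
    have hwG : Tendsto (fun p : ι × X × X => G p.1 p.2.2) (l ×ˢ (𝓝 z₀ ×ˢ 𝓝 w₀)) (𝓝 w₀) :=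
      hw.tendsto_uncurry.comp (tendsto_fst.prodMk (tendsto_snd.comp tendsto_snd))
    filter_upwards [(hzG.prodMk_nhds hwG).eventually
      (isClosed_diagonal.isOpen_compl.mem_nhds hne)] with p hp heq using absurd heq hp

theorem eventually_exists_eq [CompleteSpace X] (hG : ApproximatesIdAt G l z₀) {N : Set X}
    (hN : N ∈ 𝓝 z₀) : ∀ᶠ p : ι × X in l ×ˢ 𝓝 z₀, ∃ z ∈ N, G p.1 z = p.2 := by
  obtain ⟨s, hs, happrox⟩ := hG.exists_approximatesLinearOn
  obtain ⟨ε, hε, hball⟩ := Metric.nhds_basis_closedBall.mem_iff.1 (inter_mem hN hs)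
  have hdist : Tendsto (fun p : ι × X => dist p.2 (G p.1 z₀)) (l ×ˢ 𝓝 z₀) (𝓝 0) := by
    simpa using (tendsto_snd (g := 𝓝 z₀)).dist (hG.tendsto.comp tendsto_fst)
  let idSymm : (ContinuousLinearMap.id ℝ X).NonlinearRightInverse :=
    ⟨id, 1, fun y => by simp, fun y => rfl⟩
  filter_upwards [tendsto_fst.eventually happrox, hdist.eventually_le_const
    (show 0 < ε / 2 by positivity)] with p hp hple
  obtain ⟨z, hz, hzp⟩ := hp.surjOn_closedBall_of_nonlinearRightInverse idSymm hε.le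
    (hball.trans inter_subset_right) (a := p.2) <| by
      have hradius : ((idSymm.nnnorm : ℝ)⁻¹ - ((1 / 2 : NNReal) : ℝ)) * ε = ε / 2 := by
        simp only [idSymm, NNReal.coe_one, NNReal.coe_div, NNReal.coe_ofNat]
        ring
      rwa [Metric.mem_closedBall, hradius]
  exact ⟨z, (hball hz).1, hzp⟩

theorem eventually_isLocalDiffeomorphAt [CompleteSpace X] {n : WithTop ℕ∞} (hn : n ≠ 0)
    (hG : ApproximatesIdAt G l z₀)
    (hGn : ∀ᶠ p : ι × X in l ×ˢ 𝓝 z₀, ContDiffAt ℝ n (G p.1) p.2) :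
    ∀ᶠ p : ι × X in l ×ˢ 𝓝 z₀, IsLocalDiffeomorphAt 𝓘(ℝ, X) 𝓘(ℝ, X) n (G p.1) p.2 := by
  obtain ⟨s, hs, happrox⟩ := hG.exists_approximatesLinearOn
  obtain ⟨A, hA, u, hu, hAu⟩ := eventually_prod_iff.1 hGn
  filter_upwards [(happrox.and hA).prod_mk
    ((eventually_eventually_nhds.2 hu).and (eventually_mem_nhds_iff.2 hs))]
    with ⟨i, z⟩ ⟨⟨hi, hAi⟩, huz, hsz⟩
  have hcont : ∀ᶠ w in 𝓝 z, ContDiffAt ℝ n (G i) w := huz.mono fun w hw => hAu hAi hw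
  obtain ⟨B, hB⟩ := exists_hasFDerivAt_equiv_of_approximatesLinearOn_id hi (by norm_num) hsz
    (hcont.self_of_nhds.differentiableAt hn)
  exact isLocalDiffeomorphAt_of_hasFDerivAt_equiv hn hcont hB

end ApproximatesIdAt

end ApproximatesIdAt

section BoundaryGerms

variable {E : Type*} [NormedAddCommGroup E] [NormedSpace ℝ E]

/-- The linear map `(x, y) ↦ (x, (x - y) / t)`, which replaces the second point of a pair by its
difference quotient with the first. It is invertible for `t ≠ 0`. -/
noncomputable def diffQuotient (t : ℝ) : E × E →L[ℝ] E × E :=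
  (ContinuousLinearMap.fst ℝ E E).prod
    (t⁻¹ • (ContinuousLinearMap.fst ℝ E E - ContinuousLinearMap.snd ℝ E E))

@[simp]
theorem diffQuotient_apply (t : ℝ) (p : E × E) :
    diffQuotient t p = (p.1, t⁻¹ • (p.1 - p.2)) := rfl

theorem exists_continuousLinearEquiv_eq_diffQuotient {t : ℝ} (ht : t ≠ 0) :
    ∃ A : (E × E) ≃L[ℝ] E × E, ⇑A = diffQuotient t :=
  ⟨ContinuousLinearEquiv.equivOfInverse (diffQuotient t)
    ((ContinuousLinearMap.fst ℝ E E).prod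
      (ContinuousLinearMap.fst ℝ E E - t • ContinuousLinearMap.snd ℝ E E))
    (fun p => by simp [smul_inv_smul₀ ht]) (fun p => by simp [inv_smul_smul₀ ht]), rfl⟩

/-- The germ at `(0, z₀)` of a boundary map read in a chart of the tangent bundle: a `C²` map
`F (h, (x, v))`, `h ≥ 0`, with the expansion `x + h c v + o(h)` at `h = 0`. -/
structure IsBoundaryGerm (F : ℝ × (E × E) → E) (c : ℝ) (z₀ : E × E) : Prop where
  contDiffWithinAt : ContDiffWithinAt ℝ 2 F (Ici 0 ×ˢ univ) (0, z₀)
  eventually_apply_zero : ∀ᶠ z in 𝓝 z₀, F (0, z) = z.1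
  eventually_hasDerivWithinAt :
    ∀ᶠ z in 𝓝 z₀, HasDerivWithinAt (fun h => F (h, z)) (c • z.2) (Ici 0) 0

namespace IsBoundaryGerm

variable {F H : ℝ × (E × E) → E} {c d : ℝ} {z₀ : E × E}

theorem eventually_smul_sub_apply_zero (hF : IsBoundaryGerm F c z₀) (hH : IsBoundaryGerm H d z₀) :
    ∀ᶠ z in 𝓝 z₀, (c - d)⁻¹ • (F (0, z) - H (0, z)) = 0 := by
  filter_upwards [hF.eventually_apply_zero, hH.eventually_apply_zero] with z hFz hHz
  rw [hFz, hHz, sub_self, smul_zero]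

theorem eventually_hasDerivWithinAt_smul_sub (hF : IsBoundaryGerm F c z₀)
    (hH : IsBoundaryGerm H d z₀) (hcd : c ≠ d) :
    ∀ᶠ z in 𝓝 z₀, HasDerivWithinAt (fun h => (c - d)⁻¹ • (F (h, z) - H (h, z))) z.2 (Ici 0) 0 := by
  filter_upwards [hF.eventually_hasDerivWithinAt, hH.eventually_hasDerivWithinAt] with z hFz hHz
  refine ((hFz.sub hHz).const_smul (c - d)⁻¹).congr_deriv ?_
  rw [← sub_smul, inv_smul_smul₀ (sub_ne_zero.2 hcd)]

theorem exists_approximatesLinearOn (hF : IsBoundaryGerm F c z₀) (hH : IsBoundaryGerm H d z₀)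
    (hcd : c ≠ d) :
    ∃ s ∈ 𝓝 z₀, ∀ᶠ h in 𝓝[>] (0 : ℝ), ApproximatesLinearOn
      (fun z => diffQuotient (h * (c - d)) (F (h, z), H (h, z)))
      (ContinuousLinearMap.id ℝ (E × E)) s (1 / 2) := by
  obtain ⟨u, hu, hlipF⟩ := exists_lipschitzOnWith_sub_of_contDiffWithinAt (convex_Ici 0)
    (uniqueDiffOn_Ici 0) self_mem_Ici (hF.contDiffWithinAt.of_le one_le_two) (half_pos one_pos)
  obtain ⟨w, hw, hlipQ⟩ := exists_lipschitzOnWith_inv_smul_sub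
    ((hF.contDiffWithinAt.sub hH.contDiffWithinAt).const_smul (c - d)⁻¹)
    (hF.eventually_hasDerivWithinAt_smul_sub hH hcd) (half_pos one_pos)
  refine ⟨_, inter_mem (inter_mem hu hw) (hF.eventually_apply_zero.and
    (hF.eventually_smul_sub_apply_zero hH)), ?_⟩
  filter_upwards [nhdsWithin_mono _ Ioi_subset_Ici_self hlipF, hlipQ] with h hhF hhQ
  rintro z ⟨⟨hzu, hzw⟩, hFz, hQz⟩ z' ⟨⟨hzu', hzw'⟩, hFz', hQz'⟩
  have hfst := hhF.norm_sub_le hzu hzu'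
  have hsnd := hhQ.norm_sub_le hzw hzw'
  rw [hFz, hFz'] at hfst
  simp only [hQz, hQz', sub_zero, smul_smul, ← mul_inv] at hsnd
  rw [ContinuousLinearMap.id_apply, sub_sub_sub_comm]
  exact norm_prod_le_iff.2 ⟨hfst, hsnd⟩

theorem approximatesIdAt (hF : IsBoundaryGerm F c z₀) (hH : IsBoundaryGerm H d z₀)
    (hcd : c ≠ d) :
    ApproximatesIdAt (fun h z => diffQuotient (h * (c - d)) (F (h, z), H (h, z)))
      (𝓝[>] (0 : ℝ)) z₀ := by
  refine ⟨hF.exists_approximatesLinearOn hH hcd, Tendsto.prodMk_nhds ?_ ?_⟩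
  · have hcont := hF.eventually_hasDerivWithinAt.self_of_nhds.continuousWithinAt
    rw [ContinuousWithinAt, hF.eventually_apply_zero.self_of_nhds] at hcont
    exact hcont.mono_left (nhdsWithin_mono _ Ioi_subset_Ici_self)
  · have hslope := hasDerivWithinAt_iff_tendsto_slope.1
      (hF.eventually_hasDerivWithinAt_smul_sub hH hcd).self_of_nhds
    rw [Ici_sdiff_left] at hslope
    refine hslope.congr fun h => ?_
    rw [slope_def_module, (hF.eventually_smul_sub_apply_zero hH).self_of_nhds, sub_zero, sub_zero,
      smul_smul, ← mul_inv]
    rfl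

end IsBoundaryGerm

end BoundaryGerms

section LocalDiffeomorphisms

variable {𝕜 : Type*} [NontriviallyNormedField 𝕜]
  {E : Type*} [NormedAddCommGroup E] [NormedSpace 𝕜 E]
  {E' : Type*} [NormedAddCommGroup E'] [NormedSpace 𝕜 E']
  {F : Type*} [NormedAddCommGroup F] [NormedSpace 𝕜 F]
  {F' : Type*} [NormedAddCommGroup F'] [NormedSpace 𝕜 F']
  {H : Type*} [TopologicalSpace H] {H' : Type*} [TopologicalSpace H']
  {G : Type*} [TopologicalSpace G] {G' : Type*} [TopologicalSpace G']
  {I : ModelWithCorners 𝕜 E H} {I' : ModelWithCorners 𝕜 E' H'}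
  {J : ModelWithCorners 𝕜 F G} {J' : ModelWithCorners 𝕜 F' G'}
  {M : Type*} [TopologicalSpace M] [ChartedSpace H M]
  {M' : Type*} [TopologicalSpace M'] [ChartedSpace H' M']
  {N : Type*} [TopologicalSpace N] [ChartedSpace G N]
  {N' : Type*} [TopologicalSpace N'] [ChartedSpace G' N']
  {n : WithTop ℕ∞}

theorem isLocalDiffeomorphAt_congr_of_eventuallyEq {f g : M → N} {x : M}
    (hf : IsLocalDiffeomorphAt I J n f x) (h : g =ᶠ[𝓝 x] f) : IsLocalDiffeomorphAt I J n g x := by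
  obtain ⟨Φ, hx, hΦ⟩ := hf
  obtain ⟨s, hs, hso, hxs⟩ := eventually_nhds_iff.1 h
  let Ψ := Φ.toOpenPartialHomeomorph.restrOpen s hso
  exact ⟨{ toPartialEquiv := Ψ.toPartialEquiv
           open_source := Ψ.open_source
           open_target := Ψ.open_target
           contMDiffOn_toFun := Φ.contMDiffOn_toFun.mono inter_subset_left
           contMDiffOn_invFun := Φ.contMDiffOn_invFun.mono inter_subset_left },
    ⟨hx, hxs⟩, fun y hy => (hs y hy.2).trans (hΦ hy.1)⟩

theorem isLocalDiffeomorphAt_prodMap {f : M → N} {g : M' → N'} {x : M} {y : M'}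
    (hf : IsLocalDiffeomorphAt I J n f x) (hg : IsLocalDiffeomorphAt I' J' n g y) :
    IsLocalDiffeomorphAt (I.prod I') (J.prod J') n (Prod.map f g) (x, y) := by
  obtain ⟨Φ, hx, hΦ⟩ := hf
  obtain ⟨Ψ, hy, hΨ⟩ := hg
  exact ⟨{ toPartialEquiv := Φ.toPartialEquiv.prod Ψ.toPartialEquiv
           open_source := Φ.open_source.prod Ψ.open_source
           open_target := Φ.open_target.prod Ψ.open_target
           contMDiffOn_toFun := Φ.contMDiffOn_toFun.prodMap Ψ.contMDiffOn_toFun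
           contMDiffOn_invFun := Φ.contMDiffOn_invFun.prodMap Ψ.contMDiffOn_invFun },
    ⟨hx, hy⟩, fun p hp => Prod.ext (hΦ hp.1) (hΨ hp.2)⟩

theorem isLocalDiffeomorphAt_of_comp_left {g : M → N} {f : N → N'} {x : M}
    (hf : IsLocalDiffeomorphAt J J' n f (g x)) (hg : ContinuousAt g x)
    (h : IsLocalDiffeomorphAt I J' n (f ∘ g) x) : IsLocalDiffeomorphAt I J n g x := by
  have hcomp : IsLocalDiffeomorphAt I J n (hf.localInverse ∘ (f ∘ g)) x :=
    IsLocalDiffeomorphAt.comp (hf := h) (hg := hf.localInverse_isLocalDiffeomorphAt)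
  refine isLocalDiffeomorphAt_congr_of_eventuallyEq hcomp ?_
  filter_upwards [hg.eventually hf.localInverse_eventuallyEq_left] with y hy using hy.symm

theorem isLocalDiffeomorph_continuousLinearEquiv (A : E ≃L[𝕜] F) :
    IsLocalDiffeomorph 𝓘(𝕜, E) 𝓘(𝕜, F) n A :=
  Diffeomorph.isLocalDiffeomorph
    { A.toEquiv with
      contMDiff_toFun := A.contDiff.contMDiff
      contMDiff_invFun := A.symm.contDiff.contMDiff }

theorem isLocalDiffeomorph_subtype_val (U : Opens M) :
    IsLocalDiffeomorph I I n (Subtype.val : U → M) := by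
  intro x
  let e := U.openPartialHomeomorphSubtypeCoe ⟨x⟩
  refine ⟨{ toPartialEquiv := e.toPartialEquiv
            open_source := e.open_source
            open_target := e.open_target
            contMDiffOn_toFun := contMDiff_subtype_val.contMDiffOn
            contMDiffOn_invFun := fun y hy => ContMDiffAt.contMDiffWithinAt ?_ },
    by simp [e], fun y _ => rfl⟩
  refine (ChartedSpace.liftPropWithinAt_subtypeVal_comp_iff e.symm univ y).1 ?_
  refine contMDiffAt_id.congr_of_eventuallyEq ?_
  filter_upwards [e.open_target.mem_nhds hy] with w hw using e.right_inv hw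

theorem tendsto_extChartAt_symm {x y : M} (hy : y ∈ (extChartAt I x).source) :
    Tendsto (extChartAt I x).symm (𝓝 (extChartAt I x y)) (𝓝 y) := by
  have hcont := (continuousAt_extChartAt_symm' hy).tendsto
  rwa [(extChartAt I x).left_inv hy] at hcont

theorem isLocalDiffeomorphAt_extChartAt [IsManifold I n M] [I.Boundaryless] {x y : M}
    (hy : y ∈ (extChartAt I x).source) :
    IsLocalDiffeomorphAt I 𝓘(𝕜, E) n (extChartAt I x) y :=
  ⟨{ toPartialEquiv := extChartAt I x
     open_source := isOpen_extChartAt_source x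
     open_target := isOpen_extChartAt_target x
     contMDiffOn_toFun := by
      rw [extChartAt_source]
      exact contMDiffOn_extChartAt
     contMDiffOn_invFun := contMDiffOn_extChartAt_symm x }, hy, fun _ _ => rfl⟩

theorem exists_diffeomorph_range_of_isLocalDiffeomorph {g : M → N}
    (hg : IsLocalDiffeomorph I J n g) (hinj : Function.Injective g) :
    ∃ Φ : Diffeomorph I J M hg.image n, ∀ x, (Φ x : N) = g x := by
  have hloc : IsLocalDiffeomorph I J n fun x => (⟨g x, x, rfl⟩ : hg.image) := fun x =>
    isLocalDiffeomorphAt_of_comp_left (isLocalDiffeomorph_subtype_val hg.image _)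
      (hg.isLocalHomeomorph.continuous.subtype_mk _).continuousAt (hg x)
  refine ⟨hloc.diffeomorphOfBijective ⟨fun x y hxy => hinj (congrArg Subtype.val hxy), ?_⟩,
    fun x => rfl⟩
  rintro ⟨_, x, rfl⟩
  exact ⟨x, rfl⟩

end LocalDiffeomorphisms

section Submersions

variable {𝕜 : Type*} [NontriviallyNormedField 𝕜]
  {E : Type*} [NormedAddCommGroup E] [NormedSpace 𝕜 E]
  {F : Type*} [NormedAddCommGroup F] [NormedSpace 𝕜 F]
  {H : Type*} [TopologicalSpace H] {G : Type*} [TopologicalSpace G]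
  {I : ModelWithCorners 𝕜 E H} {J : ModelWithCorners 𝕜 F G}
  {M : Type*} [TopologicalSpace M] [ChartedSpace H M]
  {N : Type*} [TopologicalSpace N] [ChartedSpace G N] {n : WithTop ℕ∞}

theorem exists_mem_maximalAtlas_eqOn_comp {X : Type*} [TopologicalSpace X] [ChartedSpace H X]
    [IsManifold I n X] {g : X → M} {x : X}
    (hg : IsLocalDiffeomorphAt I I n g x) {c : OpenPartialHomeomorph M H}
    (hc : c ∈ IsManifold.maximalAtlas I n M) (hx : g x ∈ c.source) :
    ∃ e ∈ IsManifold.maximalAtlas I n X,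
      x ∈ e.source ∧ MapsTo g e.source c.source ∧ EqOn e (c ∘ g) e.source := by
  obtain ⟨Φ, hxΦ, hΦ⟩ := hg
  let e := Φ.toOpenPartialHomeomorph.trans c
  have hmaps : MapsTo Φ e.source c.source := fun y hy => hy.2
  refine ⟨e, e.mem_maximalAtlas_of_contMDiffOn ?_ ?_, ⟨hxΦ, ?_⟩, ?_, ?_⟩
  · exact (contMDiffOn_of_mem_maximalAtlas hc).comp
      (Φ.contMDiffOn_toFun.mono inter_subset_left) hmaps
  · exact Φ.contMDiffOn_invFun.comp
      ((contMDiffOn_symm_of_mem_maximalAtlas hc).mono inter_subset_left) fun y hy => hy.2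
  · rwa [hΦ hxΦ] at hx
  · exact hmaps.congr fun y hy => (hΦ hy.1).symm
  · exact fun y hy => congrArg c (hΦ hy.1).symm

theorem isSubmersion_fst_of_isLocalDiffeomorph [IsManifold I n M] [IsManifold J n N]
    {X : Type*} [TopologicalSpace X] [ChartedSpace (ModelProd H G) X]
    [IsManifold (I.prod J) n X] {g : X → M × N}
    (hg : IsLocalDiffeomorph (I.prod J) (I.prod J) n g) :
    Manifold.IsSubmersion (I.prod J) I n fun x => (g x).1 := by
  refine Manifold.IsSubmersionOfComplement.isSubmersion (F := F) fun x => ?_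
  obtain ⟨e, he, hxe, hmaps, heq⟩ := exists_mem_maximalAtlas_eqOn_comp (hg x)
    (IsManifold.chart_mem_maximalAtlas (I := I.prod J) (n := n) (g x)) (mem_chart_source _ _)
  refine Manifold.IsSubmersionAtOfComplement.mk_of_charts (ContinuousLinearEquiv.refl 𝕜 (E × F))
    e (chartAt H (g x).1) hxe (mem_chart_source H _) he
    (IsManifold.chart_mem_maximalAtlas _) (fun y hy => (hmaps hy).1) fun z hz => ?_
  have hsource : (e.extend (I.prod J)).symm z ∈ e.source := by
    rw [← e.extend_source (I := I.prod J)]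
    exact (e.extend (I.prod J)).map_target hz
  have hright := (e.extend (I.prod J)).right_inv hz
  rw [e.extend_coe, Function.comp_apply, heq hsource] at hright
  exact congrArg Prod.fst hright

end Submersions

section DiscreteTangentBundleCriterion

variable {E : Type*} [NormedAddCommGroup E] [NormedSpace ℝ E] [FiniteDimensional ℝ E]
  {H : Type*} [TopologicalSpace H] {I : ModelWithCorners ℝ E H} [I.Boundaryless]
  {X : Type*} [TopologicalSpace X] [ChartedSpace (ModelProd H H) X] [IsManifold (I.prod I) ∞ X]
  [T2Space X] [SecondCountableTopology X]
  {N : Type*} [TopologicalSpace N] [ChartedSpace H N] [IsManifold I ∞ N] {k : ℕ∞}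

theorem isDiscreteTangentBundle_of_isLocalDiffeomorph (hk : k ≠ 0) {dplus dminus : X → N}
    (hloc : IsLocalDiffeomorph (I.prod I) (I.prod I) k fun x => (dplus x, dminus x))
    (hinj : Function.Injective fun x => (dplus x, dminus x))
    (hdiag : ∀ m, ∃ x, dplus x = m ∧ dminus x = m) :
    IsDiscreteTangentBundle (I.prod I) I k dplus dminus := by
  have hk' : (k : WithTop ℕ∞) ≠ 0 := mod_cast hk
  have hswap : IsLocalDiffeomorph (I.prod I) (I.prod I) k fun x => (dminus x, dplus x) :=
    fun x => (hloc x).comp (hg := (Diffeomorph.prodComm I I N N k).isLocalDiffeomorph _)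
  refine ⟨inferInstance, inferInstance, by rw [Module.finrank_prod, two_mul],
    isSubmersion_fst_of_isLocalDiffeomorph hloc, isSubmersion_fst_of_isLocalDiffeomorph hswap,
    fun v w hplus hminus => ?_, fun m => ?_⟩
  · have hd := (hloc v).mdifferentiableAt hk'
    have hpair : mfderiv (I.prod I) (I.prod I) (fun x => (dplus x, dminus x)) v w = 0 := by
      rw [mfderiv_prodMk hd.fst hd.snd]
      exact Prod.ext hplus hminus
    refine ((hloc v).mfderivToContinuousLinearEquiv hk').injective ?_
    rw [map_zero]
    exact hpair
  · obtain ⟨x, hx⟩ := hdiag m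
    exact ⟨x, hx, fun y hy => hinj (Prod.ext (hy.1.trans hx.1.symm) (hy.2.trans hx.2.symm))⟩

theorem exists_isDiscreteTangentBundle_of_isLocalDiffeomorphOn (hk : k ≠ 0)
    {dplus dminus : X → N} {V : Opens X} {N₀ : Opens N}
    (hloc : IsLocalDiffeomorphOn (I.prod I) (I.prod I) k (fun x => (dplus x, dminus x)) V)
    (hinj : InjOn (fun x => (dplus x, dminus x)) V)
    (hmaps : MapsTo (fun x => (dplus x, dminus x)) V ((N₀ : Set N) ×ˢ (N₀ : Set N)))
    (hdiag : ∀ m ∈ N₀, ∃ x ∈ V, dplus x = m ∧ dminus x = m) :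
    ∃ dplus' dminus' : V → N₀,
      (∀ v : V, (dplus' v : N) = dplus v ∧ (dminus' v : N) = dminus v) ∧
      IsDiscreteTangentBundle (I.prod I) I k dplus' dminus' ∧
      ∃ W : Opens (N₀ × N₀), (∀ m : N₀, (m, m) ∈ W) ∧
        ∃ Φ : Diffeomorph (I.prod I) (I.prod I) V W k,
          ∀ v : V, (Φ v : N₀ × N₀) = (dplus' v, dminus' v) := by
  let dplus' : V → N₀ := fun v => ⟨dplus v, (hmaps v.2).1⟩
  let dminus' : V → N₀ := fun v => ⟨dminus v, (hmaps v.2).2⟩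
  have hcomp (v : V) : IsLocalDiffeomorphAt (I.prod I) (I.prod I) k
      (Prod.map Subtype.val Subtype.val ∘ fun v => (dplus' v, dminus' v)) v :=
    IsLocalDiffeomorphAt.comp (hf := isLocalDiffeomorph_subtype_val V v) (hg := hloc v)
  have hloc' : IsLocalDiffeomorph (I.prod I) (I.prod I) k fun v => (dplus' v, dminus' v) :=
    fun v => isLocalDiffeomorphAt_of_comp_left
      (isLocalDiffeomorphAt_prodMap (isLocalDiffeomorph_subtype_val N₀ (dplus' v))
        (isLocalDiffeomorph_subtype_val N₀ (dminus' v)))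
      ((IsEmbedding.subtypeVal.prodMap IsEmbedding.subtypeVal).isInducing.continuousAt_iff.2
        (hcomp v).contMDiffAt.continuousAt) (hcomp v)
  have hinj' : Function.Injective fun v => (dplus' v, dminus' v) := fun v w hvw =>
    Subtype.ext (hinj v.2 w.2 (congrArg (Prod.map Subtype.val Subtype.val) hvw))
  have hdiag' : ∀ m : N₀, ∃ v, dplus' v = m ∧ dminus' v = m := fun m => by
    obtain ⟨x, hx, hplus, hminus⟩ := hdiag m m.2
    exact ⟨⟨x, hx⟩, Subtype.ext hplus, Subtype.ext hminus⟩
  obtain ⟨Φ, hΦ⟩ := exists_diffeomorph_range_of_isLocalDiffeomorph hloc' hinj'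
  refine ⟨dplus', dminus', fun v => ⟨rfl, rfl⟩,
    isDiscreteTangentBundle_of_isLocalDiffeomorph hk hloc' hinj' hdiag', hloc'.image, fun m => ?_,
    Φ, hΦ⟩
  obtain ⟨v, hplus, hminus⟩ := hdiag' m
  exact ⟨v, Prod.ext hplus hminus⟩

end DiscreteTangentBundleCriterion

section TangentCharts

variable {E : Type*} [NormedAddCommGroup E] [NormedSpace ℝ E]
  {M : Type*} [TopologicalSpace M] [ChartedSpace E M]

theorem HasVelocityWithinAt.apply_eq {c : ℝ → M} {s : Set ℝ} {t : ℝ}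
    {v : TangentBundle 𝓘(ℝ, E) M} (h : HasVelocityWithinAt c s t v) : c t = v.proj :=
  congrArg Bundle.TotalSpace.proj h.2

theorem HasVelocityWithinAt.congr_set {c : ℝ → M} {s s' : Set ℝ} {t : ℝ}
    {v : TangentBundle 𝓘(ℝ, E) M} (h : HasVelocityWithinAt c s t v) (hs : s =ᶠ[𝓝 t] s') :
    HasVelocityWithinAt c s' t v :=
  ⟨(mdifferentiableWithinAt_congr_set hs).1 h.1, by rw [← mfderivWithin_congr_set hs]; exact h.2⟩

variable [IsManifold 𝓘(ℝ, E) ∞ M] {v w : TangentBundle 𝓘(ℝ, E) M}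

theorem extChartAt_tangent_fst (v w : TangentBundle 𝓘(ℝ, E) M) :
    (extChartAt 𝓘(ℝ, E).tangent v w).1 = extChartAt 𝓘(ℝ, E) v.proj w.proj := rfl

theorem mem_extChartAt_tangent_source :
    w ∈ (extChartAt 𝓘(ℝ, E).tangent v).source ↔ w.proj ∈ (extChartAt 𝓘(ℝ, E) v.proj).source := by
  rw [extChartAt_source, extChartAt_source]
  exact TangentBundle.mem_chart_source_iff w v

theorem extChartAt_tangent_snd (hw : w ∈ (extChartAt 𝓘(ℝ, E).tangent v).source) :
    (extChartAt 𝓘(ℝ, E).tangent v w).2 =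
      mfderiv 𝓘(ℝ, E) 𝓘(ℝ, E) (extChartAt 𝓘(ℝ, E) v.proj) w.proj w.snd := by
  rw [mem_extChartAt_tangent_source, extChartAt_source] at hw
  exact (DFunLike.congr_fun (mfderiv_chartAt_eq_tangentCoordChange (I := 𝓘(ℝ, E)) hw) w.snd).symm

theorem extChartAt_tangent_smul_snd (hw : w ∈ (extChartAt 𝓘(ℝ, E).tangent v).source) (c : ℝ) :
    (extChartAt 𝓘(ℝ, E).tangent v ⟨w.proj, c • w.snd⟩).2 =
      c • (extChartAt 𝓘(ℝ, E).tangent v w).2 := by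
  have hcw : (⟨w.proj, c • w.snd⟩ : TangentBundle 𝓘(ℝ, E) M) ∈
      (extChartAt 𝓘(ℝ, E).tangent v).source :=
    mem_extChartAt_tangent_source.2 (mem_extChartAt_tangent_source.1 hw)
  rw [extChartAt_tangent_snd hw, extChartAt_tangent_snd hcw]
  exact map_smul _ _ _

theorem HasVelocityWithinAt.hasDerivWithinAt_extChartAt {c : ℝ → M} {s : Set ℝ} {t : ℝ}
    (h : HasVelocityWithinAt c s t w) (hw : w ∈ (extChartAt 𝓘(ℝ, E).tangent v).source) :
    HasDerivWithinAt (fun r => extChartAt 𝓘(ℝ, E) v.proj (c r))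
      (extChartAt 𝓘(ℝ, E).tangent v w).2 s t := by
  obtain ⟨hc, rfl⟩ := h
  have hct : c t ∈ (chartAt E v.proj).source := by
    rwa [mem_extChartAt_tangent_source, extChartAt_source] at hw
  let A : ℝ →L[ℝ] E := (mfderiv 𝓘(ℝ, E) 𝓘(ℝ, E) (extChartAt 𝓘(ℝ, E) v.proj) (c t)).comp
    (mfderivWithin 𝓘(ℝ, ℝ) 𝓘(ℝ, E) c s t)
  have hcomp : HasFDerivWithinAt (fun r => extChartAt 𝓘(ℝ, E) v.proj (c r)) A s t :=
    hasMFDerivWithinAt_iff_hasFDerivWithinAt.1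
      ((mdifferentiableAt_extChartAt (I := 𝓘(ℝ, E)) hct).hasMFDerivAt.comp_hasMFDerivWithinAt t
        hc.hasMFDerivWithinAt)
  rw [extChartAt_tangent_snd hw]
  exact hcomp.hasDerivWithinAt

theorem t2Space_tangentBundle [T2Space M] : T2Space (TangentBundle 𝓘(ℝ, E) M) := by
  refine ⟨fun v w hvw => ?_⟩
  by_cases hproj : v.proj = w.proj
  · have hv := mem_extChartAt_source (I := 𝓘(ℝ, E).tangent) v
    have hw : w ∈ (extChartAt 𝓘(ℝ, E).tangent v).source :=
      mem_extChartAt_tangent_source.2 (hproj ▸ mem_extChartAt_source v.proj)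
    obtain ⟨s, t, hs, ht, hvs, hwt, hst⟩ :=
      t2_separation ((extChartAt 𝓘(ℝ, E).tangent v).injOn.ne hv hw hvw)
    have hcont := continuousOn_extChartAt (I := 𝓘(ℝ, E).tangent) v
    have hopen := isOpen_extChartAt_source (I := 𝓘(ℝ, E).tangent) v
    exact ⟨_, _, hcont.isOpen_inter_preimage hopen hs, hcont.isOpen_inter_preimage hopen ht,
      ⟨hv, hvs⟩, ⟨hw, hwt⟩, (hst.preimage _).mono inter_subset_right inter_subset_right⟩
  · exact separated_by_continuous (FiberBundle.continuous_proj E (TangentSpace 𝓘(ℝ, E))) hproj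

theorem secondCountableTopology_tangentBundle [SecondCountableTopology E]
    [SecondCountableTopology M] : SecondCountableTopology (TangentBundle 𝓘(ℝ, E) M) := by
  have : SecondCountableTopology (ModelProd E E) :=
    inferInstanceAs (SecondCountableTopology (E × E))
  obtain ⟨s, hs, hcover⟩ := TopologicalSpace.countable_cover_nhds (chart_source_mem_nhds E (M := M))
  refine ChartedSpace.secondCountable_of_countable_cover (ModelProd E E)
    (s := (fun m : M => (⟨m, 0⟩ : TangentBundle 𝓘(ℝ, E) M)) '' s) ?_ (hs.image _)
  refine eq_univ_of_forall fun v => ?_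
  obtain ⟨m, hm, hv⟩ := mem_iUnion₂.1 (hcover.symm ▸ mem_univ v.proj : v.proj ∈ ⋃ x ∈ s, _)
  exact mem_iUnion₂.2 ⟨_, mem_image_of_mem _ hm, (TangentBundle.mem_chart_source_iff v _).2 hv⟩

end TangentCharts

section BoundaryFamilies

variable {E : Type*} [NormedAddCommGroup E] [NormedSpace ℝ E]
  {M : Type*} [TopologicalSpace M] [ChartedSpace E M] [IsManifold 𝓘(ℝ, E) ∞ M] {k : ℕ∞}

/-- A one-parameter family of maps `β h : TM → M` that behaves for small `h ≥ 0` like a boundary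
map of a discretization: it is `C²` up to `h = 0`, `C^k` for small fixed `h > 0`, and the curve
`h ↦ β h v` starts with velocity `c v`. Only its germ along `{0} × TM` matters. -/
structure IsBoundaryFamily (k : ℕ∞) (β : ℝ → TangentBundle 𝓘(ℝ, E) M → M) (c : ℝ) : Prop where
  contMDiffWithinAt_two : ∀ v : TangentBundle 𝓘(ℝ, E) M,
    ContMDiffWithinAt (𝓘(ℝ, ℝ).prod 𝓘(ℝ, E).tangent) 𝓘(ℝ, E) 2
      (fun p : ℝ × TangentBundle 𝓘(ℝ, E) M => β p.1 p.2) (Ici 0 ×ˢ univ) (0, v)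
  eventually_contMDiffAt : ∀ v : TangentBundle 𝓘(ℝ, E) M,
    ∀ᶠ p : ℝ × TangentBundle 𝓘(ℝ, E) M in 𝓝[>] 0 ×ˢ 𝓝 v,
      ContMDiffAt 𝓘(ℝ, E).tangent 𝓘(ℝ, E) k (β p.1) p.2
  hasVelocityWithinAt : ∀ v : TangentBundle 𝓘(ℝ, E) M,
    HasVelocityWithinAt (fun h => β h v) (Ici 0) 0 ⟨v.proj, c • v.snd⟩

/-- The family `β` read in the chart of `M` at the base point of `v` and in the induced chart of
the tangent bundle. -/
noncomputable def chartRep (β : ℝ → TangentBundle 𝓘(ℝ, E) M → M) (v : TangentBundle 𝓘(ℝ, E) M) :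
    ℝ × (E × E) → E := fun p =>
  extChartAt 𝓘(ℝ, E) v.proj (β p.1 ((extChartAt 𝓘(ℝ, E).tangent v).symm p.2))

variable {β γ : ℝ → TangentBundle 𝓘(ℝ, E) M → M} {c d : ℝ} {v w : TangentBundle 𝓘(ℝ, E) M}

theorem chartRep_extChartAt (hw : w ∈ (extChartAt 𝓘(ℝ, E).tangent v).source) (h : ℝ) :
    chartRep β v (h, extChartAt 𝓘(ℝ, E).tangent v w) = extChartAt 𝓘(ℝ, E) v.proj (β h w) := by
  rw [chartRep, (extChartAt 𝓘(ℝ, E).tangent v).left_inv hw]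

namespace IsBoundaryFamily

theorem apply_zero (hβ : IsBoundaryFamily k β c) (v : TangentBundle 𝓘(ℝ, E) M) :
    β 0 v = v.proj :=
  (hβ.hasVelocityWithinAt v).apply_eq

theorem tendsto (hβ : IsBoundaryFamily k β c) (v : TangentBundle 𝓘(ℝ, E) M) :
    Tendsto (fun p : ℝ × TangentBundle 𝓘(ℝ, E) M => β p.1 p.2) (𝓝[>] 0 ×ˢ 𝓝 v) (𝓝 v.proj) := by
  have hcont := (hβ.contMDiffWithinAt_two v).continuousWithinAt.tendsto
  rw [nhdsWithin_prod_eq, nhdsWithin_univ, hβ.apply_zero] at hcont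
  exact hcont.mono_left (Filter.prod_mono (nhdsWithin_mono _ Ioi_subset_Ici_self) le_rfl)

theorem eventually_mem_extChartAt_source (hβ : IsBoundaryFamily k β c)
    (hw : w ∈ (extChartAt 𝓘(ℝ, E).tangent v).source) :
    ∀ᶠ p : ℝ × TangentBundle 𝓘(ℝ, E) M in 𝓝[>] 0 ×ˢ 𝓝 w,
      β p.1 p.2 ∈ (extChartAt 𝓘(ℝ, E) v.proj).source :=
  hβ.tendsto w ((isOpen_extChartAt_source _).mem_nhds (mem_extChartAt_tangent_source.1 hw))

theorem contDiffWithinAt_chartRep (hβ : IsBoundaryFamily k β c)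
    (hw : w ∈ (extChartAt 𝓘(ℝ, E).tangent v).source) :
    ContDiffWithinAt ℝ 2 (chartRep β v) (Ici 0 ×ˢ univ)
      (0, extChartAt 𝓘(ℝ, E).tangent v w) := by
  set e := extChartAt 𝓘(ℝ, E).tangent v
  have hsymm : ContMDiffAt 𝓘(ℝ, E × E) 𝓘(ℝ, E).tangent 2 e.symm (e w) :=
    (contMDiffOn_extChartAt_symm v).contMDiffAt
      ((isOpen_extChartAt_target v).mem_nhds (e.map_source hw))
  have hpair : ContMDiffAt (𝓘(ℝ, ℝ).prod 𝓘(ℝ, E × E)) (𝓘(ℝ, ℝ).prod 𝓘(ℝ, E).tangent) 2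
      (Prod.map id e.symm) ((0 : ℝ), e w) :=
    contMDiffAt_id.prodMap hsymm
  have hchart : ContMDiffAt 𝓘(ℝ, E) 𝓘(ℝ, E) 2 (extChartAt 𝓘(ℝ, E) v.proj) (β 0 w) := by
    rw [hβ.apply_zero]
    exact contMDiffAt_extChartAt' (by rwa [mem_extChartAt_tangent_source, extChartAt_source] at hw)
  have hcomp := hchart.comp_contMDiffWithinAt_of_eq
    ((hβ.contMDiffWithinAt_two w).comp_of_eq hpair.contMDiffWithinAt (s := Ici 0 ×ˢ univ)
      (fun p hp => ⟨hp.1, mem_univ _⟩) (by simp [e.left_inv hw])) (by simp [e.left_inv hw])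
  rw [← modelWithCornersSelf_prod, chartedSpaceSelf_prod] at hcomp
  exact hcomp.contDiffWithinAt

theorem isBoundaryGerm (hβ : IsBoundaryFamily k β c)
    (hw : w ∈ (extChartAt 𝓘(ℝ, E).tangent v).source) :
    IsBoundaryGerm (chartRep β v) c (extChartAt 𝓘(ℝ, E).tangent v w) := by
  set e := extChartAt 𝓘(ℝ, E).tangent v
  have htarget : ∀ᶠ z in 𝓝 (e w), z ∈ e.target :=
    (isOpen_extChartAt_target v).mem_nhds (e.map_source hw)
  refine ⟨hβ.contDiffWithinAt_chartRep hw, ?_, ?_⟩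
  · filter_upwards [htarget] with z hz
    rw [chartRep, hβ.apply_zero, ← extChartAt_tangent_fst, e.right_inv hz]
  · filter_upwards [htarget] with z hz
    have hsource := e.map_target hz
    have hsmul : (⟨(e.symm z).proj, c • (e.symm z).snd⟩ : TangentBundle 𝓘(ℝ, E) M) ∈ e.source :=
      mem_extChartAt_tangent_source.2 (mem_extChartAt_tangent_source.1 hsource)
    have hderiv := (hβ.hasVelocityWithinAt (e.symm z)).hasDerivWithinAt_extChartAt hsmul
    rwa [extChartAt_tangent_smul_snd hsource, e.right_inv hz] at hderiv

theorem eventually_contDiffAt_chartRep (hβ : IsBoundaryFamily k β c)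
    (hw : w ∈ (extChartAt 𝓘(ℝ, E).tangent v).source) :
    ∀ᶠ p : ℝ × TangentBundle 𝓘(ℝ, E) M in 𝓝[>] 0 ×ˢ 𝓝 w,
      ContDiffAt ℝ k (fun z => chartRep β v (p.1, z)) (extChartAt 𝓘(ℝ, E).tangent v p.2) := by
  set e := extChartAt 𝓘(ℝ, E).tangent v
  filter_upwards [hβ.eventually_contMDiffAt w, hβ.eventually_mem_extChartAt_source hw,
    tendsto_snd.eventually ((isOpen_extChartAt_source v).mem_nhds hw)] with p hp hsource hpe
  have hsymm : ContMDiffAt 𝓘(ℝ, E × E) 𝓘(ℝ, E).tangent k e.symm (e p.2) :=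
    (contMDiffOn_extChartAt_symm v).contMDiffAt
      ((isOpen_extChartAt_target v).mem_nhds (e.map_source hpe))
  have hchart : ContMDiffAt 𝓘(ℝ, E) 𝓘(ℝ, E) k (extChartAt 𝓘(ℝ, E) v.proj) (β p.1 p.2) :=
    contMDiffAt_extChartAt' (by rwa [extChartAt_source] at hsource)
  exact (hchart.comp_of_eq (hp.comp_of_eq hsymm (e.left_inv hpe))
    (congrArg (β p.1) (e.left_inv hpe))).contDiffAt

end IsBoundaryFamily

/-- The pair `(β h, γ h)` read in charts at `v`, with the second component replaced by the
difference quotient over the time step `h (c - d)`. For boundary families `β` and `γ` of speeds `c`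
and `d` it extends to the identity at `h = 0`. -/
noncomputable def rescaledPair (β γ : ℝ → TangentBundle 𝓘(ℝ, E) M → M) (c d : ℝ)
    (v : TangentBundle 𝓘(ℝ, E) M) (h : ℝ) (z : E × E) : E × E :=
  diffQuotient (h * (c - d)) (chartRep β v (h, z), chartRep γ v (h, z))

theorem rescaledPair_extChartAt (hw : w ∈ (extChartAt 𝓘(ℝ, E).tangent v).source) (h : ℝ) :
    rescaledPair β γ c d v h (extChartAt 𝓘(ℝ, E).tangent v w) =
      diffQuotient (h * (c - d))
        (extChartAt 𝓘(ℝ, E) v.proj (β h w), extChartAt 𝓘(ℝ, E) v.proj (γ h w)) := by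
  rw [rescaledPair, chartRep_extChartAt hw, chartRep_extChartAt hw]

theorem isLocalDiffeomorphAt_of_rescaledPair {h : ℝ} (hh : h * (c - d) ≠ 0)
    (hw : w ∈ (extChartAt 𝓘(ℝ, E).tangent v).source)
    (hβw : β h w ∈ (extChartAt 𝓘(ℝ, E) v.proj).source) (hβc : ContinuousAt (β h) w)
    (hγw : γ h w ∈ (extChartAt 𝓘(ℝ, E) v.proj).source) (hγc : ContinuousAt (γ h) w)
    (hloc : IsLocalDiffeomorphAt 𝓘(ℝ, E × E) 𝓘(ℝ, E × E) k (rescaledPair β γ c d v h)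
      (extChartAt 𝓘(ℝ, E).tangent v w)) :
    IsLocalDiffeomorphAt 𝓘(ℝ, E).tangent (𝓘(ℝ, E).prod 𝓘(ℝ, E)) k (fun v => (β h v, γ h v)) w := by
  obtain ⟨A, hA⟩ := exists_continuousLinearEquiv_eq_diffQuotient (E := E) hh
  have hcharts : IsLocalDiffeomorphAt (𝓘(ℝ, E).prod 𝓘(ℝ, E)) 𝓘(ℝ, E × E) k
      (Prod.map (extChartAt 𝓘(ℝ, E) v.proj) (extChartAt 𝓘(ℝ, E) v.proj)) (β h w, γ h w) := by
    rw [modelWithCornersSelf_prod, ← chartedSpaceSelf_prod]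
    exact isLocalDiffeomorphAt_prodMap (isLocalDiffeomorphAt_extChartAt hβw)
      (isLocalDiffeomorphAt_extChartAt hγw)
  refine isLocalDiffeomorphAt_of_comp_left (IsLocalDiffeomorphAt.comp (hf := hcharts)
    (hg := isLocalDiffeomorph_continuousLinearEquiv A _)) (hβc.prodMk hγc) ?_
  refine isLocalDiffeomorphAt_congr_of_eventuallyEq
    (IsLocalDiffeomorphAt.comp (hf := isLocalDiffeomorphAt_extChartAt hw) (hg := hloc)) ?_
  filter_upwards [(isOpen_extChartAt_source v).mem_nhds hw] with u hu
  simp only [Function.comp_apply, Prod.map, hA, rescaledPair_extChartAt hu]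

namespace IsBoundaryFamily

theorem approximatesIdAt_rescaledPair (hβ : IsBoundaryFamily k β c) (hγ : IsBoundaryFamily k γ d)
    (hcd : c ≠ d) (hw : w ∈ (extChartAt 𝓘(ℝ, E).tangent v).source) :
    ApproximatesIdAt (rescaledPair β γ c d v) (𝓝[>] (0 : ℝ))
      (extChartAt 𝓘(ℝ, E).tangent v w) :=
  (hβ.isBoundaryGerm hw).approximatesIdAt (hγ.isBoundaryGerm hw) hcd

theorem eventually_contDiffAt_rescaledPair (hβ : IsBoundaryFamily k β c)
    (hγ : IsBoundaryFamily k γ d) (hw : w ∈ (extChartAt 𝓘(ℝ, E).tangent v).source) :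
    ∀ᶠ p : ℝ × (E × E) in 𝓝[>] 0 ×ˢ 𝓝 (extChartAt 𝓘(ℝ, E).tangent v w),
      ContDiffAt ℝ k (rescaledPair β γ c d v p.1) p.2 := by
  set e := extChartAt 𝓘(ℝ, E).tangent v
  have htarget : ∀ᶠ z in 𝓝 (e w), z ∈ e.target :=
    (isOpen_extChartAt_target v).mem_nhds (e.map_source hw)
  filter_upwards [tendsto_snd.eventually htarget,
    (tendsto_id.prodMap (tendsto_extChartAt_symm hw)).eventually
      ((hβ.eventually_contDiffAt_chartRep hw).and (hγ.eventually_contDiffAt_chartRep hw))]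
    with p hp ⟨hpβ, hpγ⟩
  rw [Prod.map_snd, e.right_inv hp] at hpβ hpγ
  exact (diffQuotient _).contDiff.contDiffAt.comp p.2 (hpβ.prodMk hpγ)

theorem eventually_ne [T2Space M] (hβ : IsBoundaryFamily k β c) (hvw : v.proj ≠ w.proj) :
    ∀ᶠ p : ℝ × TangentBundle 𝓘(ℝ, E) M × TangentBundle 𝓘(ℝ, E) M in
      𝓝[>] 0 ×ˢ (𝓝 v ×ˢ 𝓝 w), β p.1 p.2.1 ≠ β p.1 p.2.2 :=
  (((hβ.tendsto v).comp (tendsto_fst.prodMk (tendsto_fst.comp tendsto_snd))).prodMk_nhds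
    ((hβ.tendsto w).comp (tendsto_fst.prodMk (tendsto_snd.comp tendsto_snd)))).eventually
    (isClosed_diagonal.isOpen_compl.mem_nhds hvw)

theorem eventually_eq_of_eq [T2Space M] (hβ : IsBoundaryFamily k β c) (hγ : IsBoundaryFamily k γ d)
    (hcd : c ≠ d) (v w : TangentBundle 𝓘(ℝ, E) M) :
    ∀ᶠ p : ℝ × TangentBundle 𝓘(ℝ, E) M × TangentBundle 𝓘(ℝ, E) M in 𝓝[>] 0 ×ˢ (𝓝 v ×ˢ 𝓝 w),
      (β p.1 p.2.1, γ p.1 p.2.1) = (β p.1 p.2.2, γ p.1 p.2.2) → p.2.1 = p.2.2 := by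
  by_cases hproj : v.proj = w.proj
  · set e := extChartAt 𝓘(ℝ, E).tangent v
    have hv : v ∈ e.source := mem_extChartAt_source v
    have hw : w ∈ e.source :=
      mem_extChartAt_tangent_source.2 (hproj ▸ mem_extChartAt_source v.proj)
    have htendsto : Tendsto (Prod.map id (Prod.map e e))
        (𝓝[>] (0 : ℝ) ×ˢ (𝓝 v ×ˢ 𝓝 w)) (𝓝[>] 0 ×ˢ (𝓝 (e v) ×ˢ 𝓝 (e w))) :=
      tendsto_id.prodMap ((continuousAt_extChartAt' hv).tendsto.prodMap
        (continuousAt_extChartAt' hw).tendsto)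
    filter_upwards [htendsto.eventually ((hβ.approximatesIdAt_rescaledPair hγ hcd
        hv).eventually_eq_of_eq (hβ.approximatesIdAt_rescaledPair hγ hcd hw)),
      tendsto_snd.eventually (prod_mem_prod ((isOpen_extChartAt_source v).mem_nhds hv)
        ((isOpen_extChartAt_source v).mem_nhds hw))] with p hinj ⟨hpv, hpw⟩ heq
    obtain ⟨heqβ, heqγ⟩ := Prod.mk.inj heq
    refine e.injOn hpv hpw (hinj ?_)
    simp only [Prod.map_fst, Prod.map_snd, id, e, rescaledPair_extChartAt hpv,
      rescaledPair_extChartAt hpw, heqβ, heqγ]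
  · filter_upwards [hβ.eventually_ne hproj] with p hp heq
    exact absurd (congrArg Prod.fst heq) hp

theorem eventually_exists_eq [CompleteSpace E] (hβ : IsBoundaryFamily k β c)
    (hγ : IsBoundaryFamily k γ d) (hcd : c ≠ d) {m₀ : M} {N : Set (TangentBundle 𝓘(ℝ, E) M)}
    (hN : N ∈ 𝓝 (⟨m₀, 0⟩ : TangentBundle 𝓘(ℝ, E) M)) :
    ∀ᶠ p : ℝ × M in 𝓝[>] 0 ×ˢ 𝓝 m₀, ∃ v ∈ N, β p.1 v = p.2 ∧ γ p.1 v = p.2 := by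
  set v₀ : TangentBundle 𝓘(ℝ, E) M := ⟨m₀, 0⟩
  set e := extChartAt 𝓘(ℝ, E).tangent v₀
  set φ := extChartAt 𝓘(ℝ, E) m₀
  have hv₀ : v₀ ∈ e.source := mem_extChartAt_source v₀
  have hev₀ : e v₀ = (φ m₀, 0) :=
    Prod.ext (extChartAt_tangent_fst v₀ v₀) ((extChartAt_tangent_snd hv₀).trans (map_zero _))
  obtain ⟨A, hA, u, hu, hAu⟩ := eventually_prod_iff.1
    ((hβ.eventually_mem_extChartAt_source hv₀).and (hγ.eventually_mem_extChartAt_source hv₀))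
  have hhit := (hβ.approximatesIdAt_rescaledPair hγ hcd hv₀).eventually_exists_eq
    ((tendsto_extChartAt_symm hv₀).eventually (hu.and hN))
  have hzero : Tendsto (fun m => (φ m, (0 : E))) (𝓝 m₀) (𝓝 (e v₀)) :=
    hev₀ ▸ (continuousAt_extChartAt m₀).prodMk_nhds tendsto_const_nhds
  filter_upwards [(tendsto_id.prodMap hzero).eventually hhit, hA.prod_inl _,
    tendsto_fst.eventually self_mem_nhdsWithin,
    tendsto_snd.eventually (extChartAt_source_mem_nhds (I := 𝓘(ℝ, E)) m₀)]
    with ⟨h, m⟩ ⟨z, ⟨hzu, hzN⟩, hz⟩ hhA hpos hm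
  obtain ⟨hβφ, hγφ⟩ := hAu hhA hzu
  obtain ⟨hβz, hdiff⟩ := Prod.mk.inj hz
  have hβγ : chartRep β v₀ (h, z) = chartRep γ v₀ (h, z) := by
    have hne : h * (c - d) ≠ 0 := mul_ne_zero (ne_of_gt hpos) (sub_ne_zero.2 hcd)
    exact sub_eq_zero.1 ((smul_eq_zero.1 hdiff).resolve_left (inv_ne_zero hne))
  exact ⟨e.symm z, hzN, φ.injOn hβφ hm hβz, φ.injOn hγφ hm (hβγ.symm.trans hβz)⟩

theorem eventually_isLocalDiffeomorphAt [CompleteSpace E] (hk : k ≠ 0)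
    (hβ : IsBoundaryFamily k β c) (hγ : IsBoundaryFamily k γ d) (hcd : c ≠ d)
    (v : TangentBundle 𝓘(ℝ, E) M) :
    ∀ᶠ p : ℝ × TangentBundle 𝓘(ℝ, E) M in 𝓝[>] 0 ×ˢ 𝓝 v,
      IsLocalDiffeomorphAt 𝓘(ℝ, E).tangent (𝓘(ℝ, E).prod 𝓘(ℝ, E)) k
        (fun v => (β p.1 v, γ p.1 v)) p.2 := by
  have hv := mem_extChartAt_source (I := 𝓘(ℝ, E).tangent) v
  have htendsto : Tendsto (Prod.map id (extChartAt 𝓘(ℝ, E).tangent v)) (𝓝[>] (0 : ℝ) ×ˢ 𝓝 v)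
      (𝓝[>] 0 ×ˢ 𝓝 (extChartAt 𝓘(ℝ, E).tangent v v)) :=
    tendsto_id.prodMap (continuousAt_extChartAt' hv).tendsto
  have hloc := (hβ.approximatesIdAt_rescaledPair hγ hcd hv).eventually_isLocalDiffeomorphAt
    (n := k) (mod_cast hk) (hβ.eventually_contDiffAt_rescaledPair hγ hv)
  filter_upwards [tendsto_fst.eventually self_mem_nhdsWithin, htendsto.eventually hloc,
    tendsto_snd.eventually ((isOpen_extChartAt_source v).mem_nhds hv),
    hβ.eventually_mem_extChartAt_source hv, hγ.eventually_mem_extChartAt_source hv,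
    hβ.eventually_contMDiffAt v, hγ.eventually_contMDiffAt v]
    with p hpos hp hpv hpβ hpγ hpβc hpγc
  exact isLocalDiffeomorphAt_of_rescaledPair (mul_ne_zero (ne_of_gt hpos) (sub_ne_zero.2 hcd))
    hpv hpβ hpβc.continuousAt hpγ hpγc.continuousAt hp

end IsBoundaryFamily

end BoundaryFamilies

namespace TangentBundleDiscretization

variable {E : Type*} [NormedAddCommGroup E] [NormedSpace ℝ E]
  {M : Type*} [TopologicalSpace M] [ChartedSpace E M] [IsManifold 𝓘(ℝ, E) ∞ M] {k : ℕ∞}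
  (D : TangentBundleDiscretization E M k)

theorem zero_mem_Ico : (0 : ℝ) ∈ Ico 0 D.a := ⟨le_rfl, D.a_pos⟩

theorem αplus_zero : D.αplus 0 = 0 := by
  linarith [D.αplus_nonneg 0 D.zero_mem_Ico, D.αminus_nonpos 0 D.zero_mem_Ico,
    D.αplus_sub_αminus 0 D.zero_mem_Ico]

theorem αminus_zero : D.αminus 0 = 0 := by
  linarith [D.αplus_sub_αminus 0 D.zero_mem_Ico, D.αplus_zero]

theorem derivWithin_αplus_ne_derivWithin_αminus :
    derivWithin D.αplus (Ico 0 D.a) 0 ≠ derivWithin D.αminus (Ico 0 D.a) 0 := by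
  have hplus := D.contDiffOn_αplus.differentiableOn one_ne_zero 0 D.zero_mem_Ico
  have hminus := D.contDiffOn_αminus.differentiableOn one_ne_zero 0 D.zero_mem_Ico
  have hsub : HasDerivWithinAt (D.αplus - D.αminus) 1 (Ico 0 D.a) 0 :=
    (hasDerivWithinAt_id _ _).congr D.αplus_sub_αminus (D.αplus_sub_αminus 0 D.zero_mem_Ico)
  refine sub_ne_zero.1 (ne_of_eq_of_ne ?_ one_ne_zero)
  exact (uniqueDiffOn_Ico 0 D.a 0 D.zero_mem_Ico).eq_deriv _
    (hplus.hasDerivWithinAt.sub hminus.hasDerivWithinAt) hsub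

section

variable {D} {α : ℝ → ℝ} {c : ℝ}

theorem eventually_mem_U (hα : ContinuousOn α (Ico 0 D.a)) (hα₀ : α 0 = 0)
    (v : TangentBundle 𝓘(ℝ, E) M) :
    ∀ᶠ p : ℝ × TangentBundle 𝓘(ℝ, E) M in 𝓝[≥] 0 ×ˢ 𝓝 v,
      p.1 ∈ Ico 0 D.a ∧ (p.1, α p.1, p.2) ∈ D.U := by
  rw [← nhdsWithin_Ico_eq_nhdsGE D.a_pos]
  have hαfst : Tendsto (fun p : ℝ × TangentBundle 𝓘(ℝ, E) M => α p.1)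
      (𝓝[Ico 0 D.a] 0 ×ˢ 𝓝 v) (𝓝 0) := by
    have hcont := hα 0 D.zero_mem_Ico
    rw [ContinuousWithinAt, hα₀] at hcont
    exact hcont.comp tendsto_fst
  have htendsto := (tendsto_nhds_of_tendsto_nhdsWithin
    (tendsto_fst (f := 𝓝[Ico 0 D.a] 0) (g := 𝓝 v))).prodMk_nhds
    (hαfst.prodMk_nhds tendsto_snd)
  exact (tendsto_fst.eventually self_mem_nhdsWithin).and
    (htendsto.eventually (D.isOpen_U.mem_nhds (D.zero_mem_U v)))

theorem isBoundaryFamily_of_contMDiffOn (hk : 2 ≤ k) (hα : ContinuousOn α (Ico 0 D.a))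
    (hα₀ : α 0 = 0)
    (hsmooth : ContMDiffOn (𝓘(ℝ, ℝ).prod 𝓘(ℝ, E).tangent) 𝓘(ℝ, E) k
      (fun p : ℝ × TangentBundle 𝓘(ℝ, E) M => D.ψ p.1 (α p.1) p.2)
      {p | p.1 ∈ Ico 0 D.a ∧ (p.1, α p.1, p.2) ∈ D.U})
    (hvel : ∀ v : TangentBundle 𝓘(ℝ, E) M, HasVelocityWithinAt (fun h => D.ψ h (α h) v)
      (Ico 0 D.a) 0 ⟨v.proj, c • v.snd⟩) :
    IsBoundaryFamily k (fun h => D.ψ h (α h)) c := by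
  refine ⟨fun v => ?_, fun v => ?_, fun v => ?_⟩
  · have hmem : (0, v) ∈ {p : ℝ × TangentBundle 𝓘(ℝ, E) M |
        p.1 ∈ Ico 0 D.a ∧ (p.1, α p.1, p.2) ∈ D.U} :=
      ⟨D.zero_mem_Ico, by simpa only [hα₀] using D.zero_mem_U v⟩
    refine ((hsmooth _ hmem).of_le (WithTop.coe_le_coe.2 hk)).mono_of_mem_nhdsWithin ?_
    rw [nhdsWithin_prod_eq, nhdsWithin_univ]
    exact eventually_mem_U hα hα₀ v
  · filter_upwards [Filter.prod_mono (nhdsWithin_mono _ Ioi_subset_Ici_self) le_rfl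
      (eventually_mem_U hα hα₀ v)] with ⟨h, w⟩ ⟨hh, hw⟩
    have hslice : IsOpen {w | (h, α h, w) ∈ D.U} := D.isOpen_U.preimage (by fun_prop)
    have hpair : ContMDiff 𝓘(ℝ, E).tangent (𝓘(ℝ, ℝ).prod 𝓘(ℝ, E).tangent) k
        (fun w : TangentBundle 𝓘(ℝ, E) M => (h, w)) :=
      contMDiff_const.prodMk contMDiff_id
    exact (hsmooth.comp hpair.contMDiffOn fun w hw => ⟨hh, hw⟩).contMDiffAt (hslice.mem_nhds hw)
  · refine (hvel v).congr_set ?_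
    filter_upwards [Iio_mem_nhds D.a_pos] with h hh
    exact propext (and_iff_left hh)

end

theorem isBoundaryFamily_bdryPlus (hk : 2 ≤ k) :
    IsBoundaryFamily k D.bdryPlus (derivWithin D.αplus (Ico 0 D.a) 0) :=
  isBoundaryFamily_of_contMDiffOn hk D.contDiffOn_αplus.continuousOn D.αplus_zero
    D.contMDiffOn_plus D.velocity_plus

theorem isBoundaryFamily_bdryMinus (hk : 2 ≤ k) :
    IsBoundaryFamily k D.bdryMinus (derivWithin D.αminus (Ico 0 D.a) 0) :=
  isBoundaryFamily_of_contMDiffOn hk D.contDiffOn_αminus.continuousOn D.αminus_zero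
    D.contMDiffOn_minus D.velocity_minus

theorem eventually_mem_bdryDomain (v : TangentBundle 𝓘(ℝ, E) M) :
    ∀ᶠ p : ℝ × TangentBundle 𝓘(ℝ, E) M in 𝓝[>] 0 ×ˢ 𝓝 v, p.2 ∈ D.bdryDomain p.1 := by
  have hle : 𝓝[>] (0 : ℝ) ×ˢ 𝓝 v ≤ 𝓝[≥] 0 ×ˢ 𝓝 v :=
    Filter.prod_mono (nhdsWithin_mono _ Ioi_subset_Ici_self) le_rfl
  filter_upwards [hle (eventually_mem_U D.contDiffOn_αplus.continuousOn D.αplus_zero v),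
    hle (eventually_mem_U D.contDiffOn_αminus.continuousOn D.αminus_zero v)]
    with p hplus hminus using ⟨hplus.1, hplus.2, hminus.2⟩

end TangentBundleDiscretization

section Exhaustion

theorem eventually_forall_mem_of_isCompact {ι X : Type*} [TopologicalSpace X] {l : Filter ι}
    {K : Set X} (hK : IsCompact K) {P : ι → X → Prop}
    (hP : ∀ x ∈ K, ∀ᶠ p : ι × X in l ×ˢ 𝓝 x, P p.1 p.2) : ∀ᶠ i in l, ∀ x ∈ K, P i x := by
  have hnhds : ∀ᶠ p : ι × X in l ×ˢ 𝓝ˢ K, P p.1 p.2 := hK.mem_prod_nhdsSet_of_forall hP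
  filter_upwards [hnhds.curry] with i hi using hi.self_of_nhdsSet

theorem exists_isOpen_exhaustion_of_forall_isCompact {ι X : Type*} [TopologicalSpace X]
    [WeaklyLocallyCompactSpace X] [SigmaCompactSpace X] {l : Filter ι} {r : ι → ℕ}
    (hr : Tendsto r l atTop) {P : ι → Set X → Prop} (hmono : ∀ i s t, s ⊆ t → P i t → P i s)
    (hP : ∀ K, IsCompact K → ∀ᶠ i in l, P i K) :
    ∃ U : ι → Set X, (∀ i, IsOpen (U i)) ∧ (∀ᶠ i in l, P i (U i)) ∧
      ∀ K, IsCompact K → ∀ᶠ i in l, K ⊆ U i := by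
  classical
  -- The `i`-th set is the largest member of an exhaustion, up to the growing index `r i`, on which
  -- `P i` holds.
  let C : CompactExhaustion X := default
  refine ⟨fun i => interior (C (Nat.findGreatest (fun n => P i (C n)) (r i))),
    fun i => isOpen_interior, ?_, fun K hK => ?_⟩
  · filter_upwards [hP _ (C.isCompact 0)] with i hi
    exact hmono i _ _ interior_subset
      (Nat.findGreatest_spec (P := fun n => P i (C n)) (Nat.zero_le _) hi)
  · obtain ⟨n, hn⟩ := C.exists_superset_of_isCompact hK
    filter_upwards [hP _ (C.isCompact (n + 1)), hr.eventually_ge_atTop (n + 1)] with i hi hri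
    exact hn.trans ((C.subset_interior_succ n).trans
      (interior_mono (C.subset (Nat.le_findGreatest hri hi))))

end Exhaustion

section MainTheorem

variable {E : Type*} [NormedAddCommGroup E] [NormedSpace ℝ E]
  {M : Type*} [TopologicalSpace M] [ChartedSpace E M] [IsManifold 𝓘(ℝ, E) ∞ M]
  {k : ℕ∞} {β γ : ℝ → TangentBundle 𝓘(ℝ, E) M → M} {c d : ℝ}

namespace IsBoundaryFamily

theorem eventually_isLocalDiffeomorphOn_and_injOn [CompleteSpace E] [T2Space M] (hk : k ≠ 0)
    (hβ : IsBoundaryFamily k β c) (hγ : IsBoundaryFamily k γ d) (hcd : c ≠ d)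
    {K : Set (TangentBundle 𝓘(ℝ, E) M)} (hK : IsCompact K) :
    ∀ᶠ h in 𝓝[>] (0 : ℝ),
      IsLocalDiffeomorphOn 𝓘(ℝ, E).tangent (𝓘(ℝ, E).prod 𝓘(ℝ, E)) k
        (fun v => (β h v, γ h v)) K ∧ InjOn (fun v => (β h v, γ h v)) K := by
  have hinj : ∀ q ∈ K ×ˢ K, ∀ᶠ p : ℝ × TangentBundle 𝓘(ℝ, E) M × TangentBundle 𝓘(ℝ, E) M in
      𝓝[>] 0 ×ˢ 𝓝 q,
      (β p.1 p.2.1, γ p.1 p.2.1) = (β p.1 p.2.2, γ p.1 p.2.2) → p.2.1 = p.2.2 := fun q _ => by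
    rw [nhds_prod_eq]
    exact hβ.eventually_eq_of_eq hγ hcd q.1 q.2
  filter_upwards [eventually_forall_mem_of_isCompact hK
      (P := fun h v => IsLocalDiffeomorphAt 𝓘(ℝ, E).tangent (𝓘(ℝ, E).prod 𝓘(ℝ, E)) k
        (fun v => (β h v, γ h v)) v)
      fun v _ => hβ.eventually_isLocalDiffeomorphAt hk hγ hcd v,
    eventually_forall_mem_of_isCompact (hK.prod hK)
      (P := fun h q => (β h q.1, γ h q.1) = (β h q.2, γ h q.2) → q.1 = q.2) hinj] with h hloc hinj
  exact ⟨fun v => hloc v v.2, fun v hv w hw => hinj (v, w) ⟨hv, hw⟩⟩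

theorem exists_isCompact_eventually_forall_exists_eq [FiniteDimensional ℝ E]
    (hβ : IsBoundaryFamily k β c) (hγ : IsBoundaryFamily k γ d) (hcd : c ≠ d) {C : Set M}
    (hC : IsCompact C) :
    ∃ K : Set (TangentBundle 𝓘(ℝ, E) M), IsCompact K ∧
      ∀ᶠ h in 𝓝[>] (0 : ℝ), ∀ m ∈ C, ∃ v ∈ K, β h v = m ∧ γ h v = m := by
  have : CompleteSpace E := FiniteDimensional.complete ℝ E
  have : LocallyCompactSpace (TangentBundle 𝓘(ℝ, E) M) :=
    Manifold.locallyCompact_of_finiteDimensional 𝓘(ℝ, E).tangent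
  have hzero : Continuous fun m : M => (⟨m, 0⟩ : TangentBundle 𝓘(ℝ, E) M) :=
    (Bundle.contMDiff_zeroSection ℝ (TangentSpace 𝓘(ℝ, E) : M → Type _)
      (IB := 𝓘(ℝ, E)) (n := ∞)).continuous
  obtain ⟨K, hK, hCK⟩ := exists_compact_superset (hC.image hzero)
  exact ⟨K, hK, eventually_forall_mem_of_isCompact hC fun m hm =>
    hβ.eventually_exists_eq hγ hcd (mem_interior_iff_mem_nhds.1 (hCK (mem_image_of_mem _ hm)))⟩

theorem exists_isOpen_isLocalDiffeomorphOn_and_injOn [FiniteDimensional ℝ E] [T2Space M]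
    [SecondCountableTopology M] (hk : k ≠ 0) (hβ : IsBoundaryFamily k β c)
    (hγ : IsBoundaryFamily k γ d) (hcd : c ≠ d) {dom : ℝ → Set (TangentBundle 𝓘(ℝ, E) M)}
    (hdom : ∀ v, ∀ᶠ p : ℝ × TangentBundle 𝓘(ℝ, E) M in 𝓝[>] 0 ×ˢ 𝓝 v, p.2 ∈ dom p.1) :
    ∃ U : ℝ → Set (TangentBundle 𝓘(ℝ, E) M), (∀ h, IsOpen (U h)) ∧
      (∀ᶠ h in 𝓝[>] 0, U h ⊆ dom h ∧
        IsLocalDiffeomorphOn 𝓘(ℝ, E).tangent (𝓘(ℝ, E).prod 𝓘(ℝ, E)) k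
          (fun v => (β h v, γ h v)) (U h) ∧ InjOn (fun v => (β h v, γ h v)) (U h)) ∧
      ∀ K, IsCompact K → ∀ᶠ h in 𝓝[>] 0, K ⊆ U h := by
  have : CompleteSpace E := FiniteDimensional.complete ℝ E
  have := secondCountableTopology_tangentBundle (E := E) (M := M)
  have : LocallyCompactSpace (TangentBundle 𝓘(ℝ, E) M) :=
    Manifold.locallyCompact_of_finiteDimensional 𝓘(ℝ, E).tangent
  exact exists_isOpen_exhaustion_of_forall_isCompact
    (tendsto_nat_floor_atTop.comp tendsto_inv_nhdsGT_zero)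
    (P := fun h K => K ⊆ dom h ∧ IsLocalDiffeomorphOn 𝓘(ℝ, E).tangent (𝓘(ℝ, E).prod 𝓘(ℝ, E)) k
      (fun v => (β h v, γ h v)) K ∧ InjOn (fun v => (β h v, γ h v)) K)
    (fun _ _ _ hst ⟨ht, hloc, hinj⟩ => ⟨hst.trans ht, fun v => hloc ⟨v, hst v.2⟩, hinj.mono hst⟩)
    fun K hK => (eventually_forall_mem_of_isCompact hK fun v _ => hdom v).and
      (hβ.eventually_isLocalDiffeomorphOn_and_injOn hk hγ hcd hK)

end IsBoundaryFamily

theorem mainTheorem1_general [FiniteDimensional ℝ E] [T2Space M]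
    [SecondCountableTopology M] (hk : k ≠ 0) (hβ : IsBoundaryFamily k β c)
    (hγ : IsBoundaryFamily k γ d) (hcd : c ≠ d) {dom : ℝ → Set (TangentBundle 𝓘(ℝ, E) M)}
    (hdom : ∀ v, ∀ᶠ p : ℝ × TangentBundle 𝓘(ℝ, E) M in 𝓝[>] 0 ×ˢ 𝓝 v, p.2 ∈ dom p.1)
    (M₀ : Opens M) (hM₀ : IsCompact (closure (M₀ : Set M))) :
    ∃ a : ℝ, 0 < a ∧ ∃ V : ℝ → Opens (TangentBundle 𝓘(ℝ, E) M),
      (∀ h ∈ Ioo 0 a,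
        (V h : Set (TangentBundle 𝓘(ℝ, E) M)) ⊆ dom h ∧
        ∃ dplus dminus : V h → M₀,
          (∀ v : V h, (dplus v : M) = β h v ∧ (dminus v : M) = γ h v) ∧
          IsDiscreteTangentBundle 𝓘(ℝ, E).tangent 𝓘(ℝ, E) k dplus dminus ∧
          ∃ W : Opens (M₀ × M₀), (∀ m : M₀, (m, m) ∈ W) ∧
            ∃ Φ : Diffeomorph 𝓘(ℝ, E).tangent (𝓘(ℝ, E).prod 𝓘(ℝ, E)) (V h) W k,
              ∀ v : V h, (Φ v : M₀ × M₀) = (dplus v, dminus v)) ∧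
      ∀ v : TangentBundle 𝓘(ℝ, E) M, v.proj ∈ M₀ → ∀ᶠ h in 𝓝[>] (0 : ℝ), v ∈ V h := by
  have := t2Space_tangentBundle (E := E) (M := M)
  have := secondCountableTopology_tangentBundle (E := E) (M := M)
  let pair : ℝ → TangentBundle 𝓘(ℝ, E) M → M × M := fun h v => (β h v, γ h v)
  obtain ⟨U, hUo, hU, hUK⟩ := hβ.exists_isOpen_isLocalDiffeomorphOn_and_injOn hk hγ hcd hdom
  obtain ⟨K, hK, hdiag⟩ := hβ.exists_isCompact_eventually_forall_exists_eq hγ hcd hM₀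
  have hopen : ∀ᶠ h in 𝓝[>] (0 : ℝ), IsOpen (U h ∩ pair h ⁻¹' (M₀ ×ˢ M₀)) := by
    filter_upwards [hU] with h ⟨_, hloc, _⟩
    exact hloc.contMDiffOn.continuousOn.isOpen_inter_preimage (hUo h)
      (M₀.isOpen.prod M₀.isOpen)
  -- The interior only matters for large `h`, where the intersection may fail to be open.
  let V : ℝ → Opens (TangentBundle 𝓘(ℝ, E) M) := fun h =>
    ⟨interior (U h ∩ pair h ⁻¹' (M₀ ×ˢ M₀)), isOpen_interior⟩
  obtain ⟨a, ha, hIoo⟩ := mem_nhdsGT_iff_exists_Ioo_subset.1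
    (((hU.and hopen).and (hUK K hK)).and hdiag)
  refine ⟨a, ha, V, fun h hh => ?_, fun v hv => ?_⟩
  · obtain ⟨⟨⟨⟨hdomU, hloc, hinj⟩, ho⟩, hKU⟩, hd⟩ := hIoo hh
    have hVU : (V h : Set (TangentBundle 𝓘(ℝ, E) M)) ⊆ U h :=
      interior_subset.trans inter_subset_left
    refine ⟨hVU.trans hdomU, exists_isDiscreteTangentBundle_of_isLocalDiffeomorphOn hk
      (fun v => hloc ⟨v, hVU v.2⟩) (hinj.mono hVU)
      (fun v hv => (interior_subset hv).2) fun m hm => ?_⟩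
    obtain ⟨v, hvK, hβv, hγv⟩ := hd m (subset_closure hm)
    have hvM : pair h v ∈ (M₀ : Set M) ×ˢ M₀ := by
      simpa only [pair, hβv, hγv] using mk_mem_prod hm hm
    exact ⟨v, ho.subset_interior_iff.2 subset_rfl ⟨hKU hvK, hvM⟩, hβv, hγv⟩
  · have hpair := ((hβ.tendsto v).prodMk_nhds (hγ.tendsto v)).comp
      (tendsto_id.prodMk tendsto_const_nhds)
    filter_upwards [hUK {v} isCompact_singleton, hopen,
      hpair ((M₀.isOpen.prod M₀.isOpen).mem_nhds ⟨hv, hv⟩)] with h hvU ho hvM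
    exact ho.subset_interior_iff.2 subset_rfl ⟨hvU rfl, hvM⟩

end MainTheorem

theorem mainTheorem1
    {E : Type*} [NormedAddCommGroup E] [NormedSpace ℝ E] [FiniteDimensional ℝ E]
    {M : Type*} [TopologicalSpace M] [T2Space M] [SecondCountableTopology M]
    [ChartedSpace E M] [IsManifold 𝓘(ℝ, E) ∞ M]
    {k : ℕ∞} (hk : 2 ≤ k) (D : TangentBundleDiscretization E M k)
    (M₀ : Opens M) (hM₀ : IsCompact (closure (M₀ : Set M))) :
    ∃ a : ℝ, 0 < a ∧ ∃ V : ℝ → Opens (TangentBundle 𝓘(ℝ, E) M),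
      (∀ h ∈ Ioo 0 a,
        (V h : Set (TangentBundle 𝓘(ℝ, E) M)) ⊆ D.bdryDomain h ∧
        ∃ dplus dminus : V h → M₀,
          (∀ v : V h, (dplus v : M) = D.bdryPlus h v ∧ (dminus v : M) = D.bdryMinus h v) ∧
          IsDiscreteTangentBundle 𝓘(ℝ, E).tangent 𝓘(ℝ, E) k dplus dminus ∧
          ∃ W : Opens (M₀ × M₀), (∀ m : M₀, (m, m) ∈ W) ∧
            ∃ Φ : Diffeomorph 𝓘(ℝ, E).tangent (𝓘(ℝ, E).prod 𝓘(ℝ, E)) (V h) W k,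
              ∀ v : V h, (Φ v : M₀ × M₀) = (dplus v, dminus v)) ∧
      ∀ v : TangentBundle 𝓘(ℝ, E) M, v.proj ∈ M₀ → ∀ᶠ h in 𝓝[>] (0 : ℝ), v ∈ V h :=
  mainTheorem1_general (ne_of_gt (two_pos.trans_le hk)) (D.isBoundaryFamily_bdryPlus hk)
    (D.isBoundaryFamily_bdryMinus hk) D.derivWithin_αplus_ne_derivWithin_αminus
    D.eventually_mem_bdryDomain M₀ hM₀
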